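/- Let $1\le k\le N$, let $f_1,\dots,f_N$ be real affine forms on $\mathbb R^k$ whose hyperplanes $H_j=\{f_j=0\}$ are distinct and generic (any $k$ of them meet in exactly one point, no $k+1$ of them have a common point), let $l_j=f_j-f_j(0)$, and let $\alpha_1,\dots,\alpha_N>0$; for $U\subset\{1,\dots,N\}$ put $\alpha_U=\sum_{j\in U}\alpha_j$. Let $f_0$ be a linear form on $\mathbb R^k$ that takes distinct values at the vertices of the arrangement and is nonconstant on the intersection line of any $k-1$ of the hyperplanes. A vertex $X$ is regarded both as a $k$-element subset of $\{1,\dots,N\}$ and as the point $\bigcap_{j\in X}H_j$. Let $\mathcal D^+$ be the set of connected components of $\mathbb R^k\setminus\bigcup_jH_j$ on which $f_0$ is bounded from below. For a vertex $X$ let $\Delta_X$ be the unique component having $X$ in its boundary and on which $f_0>f_0(X)$. For $j\in X$ let $e_{X\setminus\{j\}}$ be the vector with $l_i(e_{X\setminus\{j\}})=0$ for all $i\in X\setminus\{j\}$ and $f_0(e_{X\setminus\{j\}})=1$, and for $\rho\in\mathbb C$, $|\rho|=1$, put $$\mathcal C_X^\rho=\Big\{X+\rho\sum_{j\in X}a_je_{X\setminus\{j\}}\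 :\ a_j>0\Big\}\subset\mathbb C^k,\qquad \mathcal C_X^+=\mathcal C_X^1\subset\mathbb R^k .$$ Fix an orientation of $\mathbb R^k$. For a vertex $X'=\{j_1,\dots,j_k\}$, ordered so that $df_{j_1}\wedge\dots\wedge df_{j_k}$ is positively oriented, let $\omega_{X'}=\frac{df_{j_1}}{f_{j_1}}\wedge\dots\wedge\frac{df_{j_k}}{f_{j_k}}$. For $\Delta\in\mathcal D^+$ and $\lambda>0$ let $I_\Delta(\lambda)$ be the vector, indexed by the vertices $X'$, with components $$I_{\Delta,X'}(\lambda)=\int_\Delta e^{-\lambda f_0}\prod_{j=1}^N|f_j|^{\alpha_j}\,\omega_{X'} .$$ For a vertex $X$ and $\rho\notin\mathbb R$, $|\rho|=1$, $\operatorname{Re}(\rho\lambda)>0$, let $I_X^\rho(\lambda)$ be the vector with components $$I_{X,X'}^\rho(\lambda)=\int_{\mathcal C_X^\rho}e^{-\lambda f_0}\Big(\prod_{j=1}^N|f_j|^{\alpha_j}\Big)\omega_{X'} ,$$ where $f_0,f_1,\dots,f_N$ and $\omega_{X'}$ are extended to $\mathbb C^k$, the cone $\mathcal C_X^\rho$ is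 oriented as the image of $\mathcal C_X^+$ under $x\mapsto X+\rho(x-X)$, and $\prod_j|f_j|^{\alpha_j}$ stands for the analytic continuation of this positive function from $\Delta_X$, along a domain of $\mathbb C^k$ that avoids the complexified hyperplanes and contains all the cones $\mathcal C_X^{\rho'}$, $|\rho'|=1$, with $\operatorname{Im}\rho'$ of the same sign as $\operatorname{Im}\rho$. For domains $\Delta,\Delta'$ let $\mathcal H(\Delta,\Delta')$ be the set of all $j$ such that $H_j$ separates $\Delta$ from $\Delta'$, and put $\psi(\Delta,X)=1$ if $\Delta=\Delta_X$, and $\psi(\Delta,X)=(-1)^{|\mathcal H(\Delta,\Delta_X)|}e^{i\pi\alpha_{\mathcal H(\Delta,\Delta_X)}}$ otherwise. Then for every $\Delta\in\mathcal D^+$ and every $\lambda>0$ all these integrals converge absolutely; for each vertex $X$ the vector $I_X^\rho(\lambda)$ has a value $I_X^+(\lambda)$ that is the same for all $\rho$ with $|\rho|=1$, $\operatorname{Im}\rho<0$, $\operatorname{Re}(\rho\lambda)>0$, and a value $I_X^-(\lambda)$ that is the same for all $\rho$ with $|\rho|=1$, $\operatorname{Im}\rho>0$, $\operatorname{Re}(\rho\lambda)>0$;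 and $$I_\Delta(\lambda)=\sum_{X\in\partial\Delta}\psi(\Delta,X)\,I_X^+(\lambda),\qquad I_\Delta(\lambda)=\sum_{X\in\partial\Delta}\overline{\psi(\Delta,X)}\,I_X^-(\lambda),$$ the sums being over all vertices $X$ in the boundary of $\Delta$. -/

import Mathlib

open Set Filter Topology MeasureTheory

noncomputable section

/-- A generic weighted arrangement of `N` affine hyperplanes `H j = {f j = 0}` in `ℝ^k`, with
positive weights `α j`, together with a linear form `f0` in general position. -/
structure Arrangement (k N : ℕ) where
  /-- the affine forms -/
  f : Fin N → ((Fin k → ℝ) →ᵃ[ℝ] ℝ)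
  /-- the linear form in the exponential -/
  f0 : (Fin k → ℝ) →ₗ[ℝ] ℝ
  /-- the weights -/
  α : Fin N → ℝ
  /-- the dimension is positive, and there are at least `k` hyperplanes -/
  k_pos : 0 < k
  k_le : k ≤ N
  α_pos : ∀ j, 0 < α j
  /-- the hyperplanes are distinct -/
  distinct : Function.Injective fun j => {x | f j x = 0}
  /-- any `k` hyperplanes meet in exactly one point -/
  inter_k : ∀ X : Finset (Fin N), X.card = k → ∃! x, ∀ j ∈ X, f j x = 0
  /-- any `k + 1` hyperplanes have empty intersection -/
  inter_succ : ∀ Y : Finset (Fin N), Y.card = k + 1 → ¬ ∃ x, ∀ j ∈ Y, f j x = 0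
  /-- `f0` takes distinct values on the vertices -/
  f0_vertices : ∀ X Y : Finset (Fin N), X.card = k → Y.card = k → X ≠ Y →
    ∀ x y, (∀ j ∈ X, f j x = 0) → (∀ j ∈ Y, f j y = 0) → f0 x ≠ f0 y
  /-- `f0` is nonconstant on the intersection line of any `k - 1` hyperplanes -/
  f0_edges : ∀ U : Finset (Fin N), U.card + 1 = k →
    ∃ x y, (∀ j ∈ U, f j x = 0) ∧ (∀ j ∈ U, f j y = 0) ∧ f0 x ≠ f0 y

namespace Arrangement

variable {k N : ℕ} (A : Arrangement k N)

/-- Vertices, as subsets of `{1, …, N}` with `k` elements. -/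
abbrev Vertex (_A : Arrangement k N) : Type := {X : Finset (Fin N) // X.card = k}

/-- The point of `ℝ^k` at which the hyperplanes of the vertex `X` meet. -/
def point (X : A.Vertex) : Fin k → ℝ := (A.inter_k X.1 X.2).choose

/-- The linear form `l j = f j - f j 0` directing `f j`. -/
def l (j : Fin N) : (Fin k → ℝ) →ₗ[ℝ] ℝ := (A.f j).linear

lemma f_point (X : A.Vertex) {j : Fin N} (hj : j ∈ X.1) : A.f j (A.point X) = 0 :=
  (A.inter_k X.1 X.2).choose_spec.1 j hj

lemma f_point_ne (X : A.Vertex) {j : Fin N} (hj : j ∉ X.1) : A.f j (A.point X) ≠ 0 := by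
  intro h
  refine A.inter_succ (insert j X.1) (by rw [Finset.card_insert_of_notMem hj, X.2])
    ⟨A.point X, fun i hi => ?_⟩
  rcases Finset.mem_insert.1 hi with rfl | hi
  · exact h
  · exact A.f_point X hi

lemma f_add (j : Fin N) (x v : Fin k → ℝ) : A.f j (x + v) = A.f j x + A.l j v := by
  have := (A.f j).map_vadd x v
  simp only [vadd_eq_add] at this
  rw [add_comm x v, this, add_comm, l]

lemma eq_zero_of_l (X : A.Vertex) (v : Fin k → ℝ) (hv : ∀ j ∈ X.1, A.l j v = 0) : v = 0 := by
  have h := (A.inter_k X.1 X.2).choose_spec.2 (A.point X + v) (fun j hj => by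
    rw [A.f_add, A.f_point X hj, hv j hj, add_zero])
  have h' : A.point X + v = A.point X := h
  simpa using h'

lemma existsUnique_edge (X : A.Vertex) (j : {j // j ∈ X.1}) :
    ∃! e : Fin k → ℝ, (∀ i ∈ X.1.erase j.1, A.l i e = 0) ∧ A.f0 e = 1 := by
  obtain ⟨x, y, hx, hy, hne⟩ := A.f0_edges (X.1.erase j.1)
    (by rw [Finset.card_erase_add_one j.2, X.2])
  have key : ∀ i ∈ X.1.erase j.1, A.l i (x - y) = 0 := by
    intro i hi
    have := A.f_add i y (x - y)
    rw [add_sub_cancel, hx i hi, hy i hi] at this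
    linarith
  have hsub : A.f0 x - A.f0 y ≠ 0 := sub_ne_zero.2 hne
  refine ⟨(A.f0 x - A.f0 y)⁻¹ • (x - y), ⟨fun i hi => by rw [map_smul, key i hi, smul_zero],
    by rw [map_smul, map_sub, smul_eq_mul, inv_mul_cancel₀ hsub]⟩, ?_⟩
  have uniq : ∀ e e' : Fin k → ℝ, ((∀ i ∈ X.1.erase j.1, A.l i e = 0) ∧ A.f0 e = 1) →
      ((∀ i ∈ X.1.erase j.1, A.l i e' = 0) ∧ A.f0 e' = 1) → e' = e := by
    rintro e e' ⟨h1, h2⟩ ⟨h1', h2'⟩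
    have hz : A.l j.1 e • e' - A.l j.1 e' • e = 0 := by
      refine A.eq_zero_of_l X _ fun i hi => ?_
      by_cases hij : i = j.1
      · subst hij; simp [mul_comm]
      · have hi' := Finset.mem_erase.2 ⟨hij, hi⟩
        simp [h1 i hi', h1' i hi']
    have hlj : A.l j.1 e ≠ 0 := by
      intro h0
      have : e = 0 := by
        refine A.eq_zero_of_l X _ fun i hi => ?_
        by_cases hij : i = j.1
        · rw [hij]; exact h0
        · exact h1 i (Finset.mem_erase.2 ⟨hij, hi⟩)
      rw [this, map_zero] at h2
      exact zero_ne_one h2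
    have h0 := congrArg A.f0 hz
    rw [map_sub, map_smul, map_smul, h2, h2', map_zero, smul_eq_mul, smul_eq_mul, mul_one,
      mul_one, sub_eq_zero] at h0
    rw [← h0, ← smul_sub] at hz
    exact sub_eq_zero.1 ((smul_eq_zero.1 hz).resolve_left hlj)
  intro e' he'
  exact uniq _ _ ⟨fun i hi => by rw [map_smul, key i hi, smul_zero],
    by rw [map_smul, map_sub, smul_eq_mul, inv_mul_cancel₀ hsub]⟩ he'

/-- For `j ∈ X`, the vector directing the edge `⋂ i ∈ X \ {j}, H i`, normalized by `f0 = 1`. -/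
def edge (X : A.Vertex) (j : {j // j ∈ X.1}) : Fin k → ℝ := (A.existsUnique_edge X j).choose

lemma l_edge (X : A.Vertex) (j : {j // j ∈ X.1}) {i : Fin N} (hi : i ∈ X.1) (hij : i ≠ j.1) :
    A.l i (A.edge X j) = 0 :=
  (A.existsUnique_edge X j).choose_spec.1.1 i (Finset.mem_erase.2 ⟨hij, hi⟩)

lemma f0_edge (X : A.Vertex) (j : {j // j ∈ X.1}) : A.f0 (A.edge X j) = 1 :=
  (A.existsUnique_edge X j).choose_spec.1.2

lemma l_edge_self (X : A.Vertex) (j : {j // j ∈ X.1}) : A.l j.1 (A.edge X j) ≠ 0 := by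
  intro h0
  have h : A.edge X j = 0 := by
    refine A.eq_zero_of_l X _ fun i hi => ?_
    by_cases hij : i = j.1
    · rw [hij]; exact h0
    · exact A.l_edge X j hi hij
  have h1 := A.f0_edge X j
  rw [h, map_zero] at h1
  exact zero_ne_one h1

/-- The open cone `C_X^+ = {X + ∑ a j • e_{X \ {j}}, a j > 0}`: the cone cut out by the
hyperplanes of `X` on which `f0 > f0(X)`. -/
def cone (X : A.Vertex) : Set (Fin k → ℝ) :=
  {x | ∃ a : {j // j ∈ X.1} → ℝ, (∀ j, 0 < a j) ∧ x = A.point X + ∑ j, a j • A.edge X j}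

/-- The complement of the hyperplanes. -/
def compl : Set (Fin k → ℝ) := {x | ∀ j, A.f j x ≠ 0}

/-- The arrangement domains: connected components of the complement of the hyperplanes. -/
def domains : Set (Set (Fin k → ℝ)) :=
  {Δ | ∃ x ∈ A.compl, Δ = connectedComponentIn A.compl x}

/-- The arrangement domains on which `f0` is bounded from below. -/
def domainsPlus : Set (Set (Fin k → ℝ)) :=
  {Δ | Δ ∈ A.domains ∧ BddBelow (A.f0 '' Δ)}

lemma continuous_f (j : Fin N) : Continuous (A.f j) :=
  (A.f j).continuous_of_finiteDimensional

/-- A domain is determined by the signs of the forms on it. -/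
lemma component_eq {x : Fin k → ℝ} (hx : x ∈ A.compl) :
    connectedComponentIn A.compl x = {y | ∀ j, 0 < A.f j x * A.f j y} := by
  apply Subset.antisymm
  · intro y hy j
    by_contra hneg
    push Not at hneg
    have hpre : IsPreconnected (A.f j '' connectedComponentIn A.compl x) :=
      isPreconnected_connectedComponentIn.image _ (A.continuous_f j).continuousOn
    have hxm : A.f j x ∈ A.f j '' connectedComponentIn A.compl x :=
      mem_image_of_mem _ (mem_connectedComponentIn hx)
    have hym := mem_image_of_mem (A.f j) hy
    have h0 : (0 : ℝ) ∈ A.f j '' connectedComponentIn A.compl x := by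
      rcases le_total (A.f j x) 0 with h | h
      · have hx' : A.f j x < 0 := lt_of_le_of_ne h (hx j)
        exact hpre.ordConnected.out hxm hym ⟨h, by nlinarith⟩
      · have hx' : 0 < A.f j x := lt_of_le_of_ne h (hx j).symm
        exact hpre.ordConnected.out hym hxm ⟨by nlinarith, h⟩
    obtain ⟨z, hz, hz0⟩ := h0
    exact connectedComponentIn_subset _ _ hz j hz0
  · have hconv : Convex ℝ {y | ∀ j, 0 < A.f j x * A.f j y} := by
      rw [Set.ofPred_forall]
      refine convex_iInter fun j => ?_
      intro y hy z hz a b ha hb hab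
      simp only [Set.mem_ofPred_eq] at hy hz ⊢
      rw [Convex.combo_affine_apply hab, smul_eq_mul, smul_eq_mul]
      rcases ha.eq_or_lt with h | h
      · have : b = 1 := by linarith
        subst this; rw [← h]; linarith
      · nlinarith [mul_pos h hy, mul_nonneg hb hz.le]
    refine hconv.isPreconnected.subset_connectedComponentIn
      (fun j => mul_self_pos.2 (hx j)) fun y hy j h0 => ?_
    have := hy j
    rw [h0, mul_zero] at this
    exact lt_irrefl _ this

lemma exists_small (X : A.Vertex) (w : Fin k → ℝ) (r : ℝ) (hr : 0 < r) :
    ∃ ε : ℝ, 0 < ε ∧ ε < r ∧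
      ∀ j ∉ X.1, 0 < A.f j (A.point X) * A.f j (A.point X + ε • w) := by
  have h : ∀ᶠ ε : ℝ in 𝓝[>] 0,
      ∀ j ∉ X.1, 0 < A.f j (A.point X) * A.f j (A.point X + ε • w) := by
    rw [Filter.eventually_all]
    intro j
    by_cases hj : j ∈ X.1
    · exact Eventually.of_forall fun _ h => absurd hj h
    · have hc : Continuous fun ε : ℝ => A.f j (A.point X) * A.f j (A.point X + ε • w) := by
        have := A.continuous_f j
        fun_prop
      have h0 : 0 < A.f j (A.point X) * A.f j (A.point X + (0 : ℝ) • w) := by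
        rw [zero_smul, add_zero]; exact mul_self_pos.2 (A.f_point_ne X hj)
      filter_upwards [nhdsWithin_le_nhds (hc.continuousAt.eventually (lt_mem_nhds h0))] with ε hε
      exact fun _ => hε
  obtain ⟨ε, h1, h2, h3⟩ := ((h.and (Ioo_mem_nhdsGT hr)).exists)
  exact ⟨ε, h2, h3, h1⟩

lemma eq_sum_edge (X : A.Vertex) (v : Fin k → ℝ) :
    v = ∑ j : {j // j ∈ X.1}, (A.l j.1 v / A.l j.1 (A.edge X j)) • A.edge X j := by
  rw [← sub_eq_zero]
  refine A.eq_zero_of_l X _ fun i hi => ?_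
  rw [map_sub, map_sum, Finset.sum_eq_single (⟨i, hi⟩ : {j // j ∈ X.1})]
  · rw [map_smul, smul_eq_mul, div_mul_cancel₀ _ (A.l_edge_self X ⟨i, hi⟩), sub_self]
  · intro j _ hj
    rw [map_smul, A.l_edge X j hi (fun h => hj (Subtype.ext h.symm)), smul_zero]
  · simp

lemma f0_eq_sum (X : A.Vertex) (v : Fin k → ℝ) :
    A.f0 v = ∑ j : {j // j ∈ X.1}, A.l j.1 v / A.l j.1 (A.edge X j) := by
  conv_lhs => rw [A.eq_sum_edge X v]
  rw [map_sum]
  exact Finset.sum_congr rfl fun j _ => by rw [map_smul, A.f0_edge, smul_eq_mul, mul_one]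

lemma l_sum_edge (X : A.Vertex) (a : {j // j ∈ X.1} → ℝ) (i : {j // j ∈ X.1}) :
    A.l i.1 (∑ j, a j • A.edge X j) = a i * A.l i.1 (A.edge X i) := by
  rw [map_sum, Finset.sum_eq_single i]
  · rw [map_smul, smul_eq_mul]
  · intro j _ hj
    rw [map_smul, A.l_edge X j i.2 (fun h => hj (Subtype.ext h.symm)), smul_zero]
  · simp

/-- The domains having the vertex `X` in their boundary and on which `f0 - f0(X) > 0`. -/
def IsDomainAt (X : A.Vertex) (Δ : Set (Fin k → ℝ)) : Prop :=
  Δ ∈ A.domains ∧ A.point X ∈ frontier Δ ∧ ∀ x ∈ Δ, A.f0 (A.point X) < A.f0 x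

/-- The sign description of such a domain. -/
lemma isDomainAt_signs (X : A.Vertex) {Δ : Set (Fin k → ℝ)} (h : A.IsDomainAt X Δ) :
    Δ = {y | (∀ j : {j // j ∈ X.1}, 0 < A.l j.1 (A.edge X j) * A.f j.1 y) ∧
      ∀ j ∉ X.1, 0 < A.f j (A.point X) * A.f j y} := by
  obtain ⟨⟨x, hx, rfl⟩, hfr, hpos⟩ := h
  rw [A.component_eq hx] at hfr hpos ⊢
  have hout : ∀ j ∉ X.1, 0 < A.f j (A.point X) * A.f j x := by
    intro j hj
    have hcl : A.point X ∈ {y | 0 ≤ A.f j x * A.f j y} := by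
      have hclosed : IsClosed {y | 0 ≤ A.f j x * A.f j y} :=
        isClosed_le continuous_const (continuous_const.mul (A.continuous_f j))
      exact hclosed.closure_subset_iff.2 (fun y hy => (hy j).le) (frontier_subset_closure hfr)
    rw [mul_comm]
    exact lt_of_le_of_ne hcl (mul_ne_zero (hx j) (A.f_point_ne X hj)).symm
  have hin : ∀ j : {j // j ∈ X.1}, 0 < A.l j.1 (A.edge X j) * A.f j.1 x := by
    intro j
    by_contra hneg
    push Not at hneg
    have hlt : A.l j.1 (A.edge X j) * A.f j.1 x < 0 :=
      lt_of_le_of_ne hneg (mul_ne_zero (A.l_edge_self X j) (hx j.1))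
    set v := x - A.point X with hv
    set M := |A.f0 v| + 1 with hM
    have hMpos : 0 < M := by positivity
    obtain ⟨ε, hε, -, hsm⟩ := A.exists_small X (v - M • A.edge X j) 1 one_pos
    have hlv : ∀ i ∈ X.1, A.l i v = A.f i x := by
      intro i hi
      have := A.f_add i (A.point X) v
      rw [hv, add_sub_cancel, A.f_point X hi, zero_add] at this
      rw [hv, ← this]
    have hmem : A.point X + ε • (v - M • A.edge X j) ∈ {y | ∀ j, 0 < A.f j x * A.f j y} := by
      intro i
      by_cases hi : i ∈ X.1
      · rw [A.f_add, A.f_point X hi, zero_add, map_smul, map_sub, map_smul, hlv i hi,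
          smul_eq_mul, smul_eq_mul]
        have hxx : 0 < A.f i x * A.f i x := mul_self_pos.2 (hx i)
        by_cases hij : i = j.1
        · subst hij
          have h1 : 0 < A.f j.1 x * A.f j.1 x - M * (A.l j.1 (A.edge X j) * A.f j.1 x) := by
            nlinarith
          nlinarith [mul_pos hε h1]
        · rw [A.l_edge X j hi hij]
          nlinarith [mul_pos hε hxx]
      · have h1 := hsm i hi
        have h2 := hout i hi
        have h3 : 0 < A.f i (A.point X) * A.f i (A.point X) := mul_self_pos.2 (A.f_point_ne X hi)
        have h4 := mul_pos h2 h1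
        by_contra hcon
        push Not at hcon
        nlinarith [mul_nonneg h3.le (neg_nonneg.2 hcon)]
    have h1 := hpos _ hmem
    rw [map_add, map_smul, map_sub, map_smul, A.f0_edge, smul_eq_mul, smul_eq_mul] at h1
    have h2 : A.f0 v - M * 1 < 0 := by
      have := le_abs_self (A.f0 v)
      linarith
    nlinarith
  have aux : ∀ a b c : ℝ, 0 < a * b → (0 < b * c ↔ 0 < a * c) := by
    intro a b c hab
    have e : (a * b) * (b * c) = (b * b) * (a * c) := by ring
    have hbb : 0 < b * b := mul_self_pos.2 fun h => by simp [h] at hab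
    constructor
    · intro h
      have := mul_pos hab h
      rw [e] at this
      exact (mul_pos_iff_of_pos_left hbb).1 this
    · intro h
      have := mul_pos hbb h
      rw [← e] at this
      exact (mul_pos_iff_of_pos_left hab).1 this
  ext y
  constructor
  · intro hy
    exact ⟨fun j => (aux _ _ _ (hin j)).1 (hy j.1), fun j hj => (aux _ _ _ (hout j hj)).1 (hy j)⟩
  · rintro ⟨h1, h2⟩ j
    by_cases hj : j ∈ X.1
    · exact (aux _ _ _ (hin ⟨j, hj⟩)).2 (h1 ⟨j, hj⟩)
    · exact (aux _ _ _ (hout j hj)).2 (h2 j hj)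

lemma exists_isDomainAt (X : A.Vertex) : ∃ Δ, A.IsDomainAt X Δ := by
  set w : Fin k → ℝ := ∑ j, (1 : ℝ) • A.edge X j with hw
  have hlw : ∀ i : {j // j ∈ X.1}, A.l i.1 w = A.l i.1 (A.edge X i) := fun i => by
    rw [hw, A.l_sum_edge X (fun _ => 1) i, one_mul]
  have hpt : ∀ ε : ℝ, 0 < ε →
      (∀ j ∉ X.1, 0 < A.f j (A.point X) * A.f j (A.point X + ε • w)) →
      A.point X + ε • w ∈ {y | (∀ j : {j // j ∈ X.1}, 0 < A.l j.1 (A.edge X j) * A.f j.1 y) ∧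
        ∀ j ∉ X.1, 0 < A.f j (A.point X) * A.f j y} := by
    intro ε hε h
    refine ⟨fun j => ?_, h⟩
    rw [A.f_add, A.f_point X j.2, zero_add, map_smul, hlw, smul_eq_mul]
    have := mul_self_pos.2 (A.l_edge_self X j)
    nlinarith [mul_pos hε this]
  obtain ⟨ε, hε, -, hs⟩ := A.exists_small X w 1 one_pos
  set x := A.point X + ε • w with hx
  have hxm := hpt ε hε hs
  have hxc : x ∈ A.compl := by
    intro j h0
    by_cases hj : j ∈ X.1
    · have := hxm.1 ⟨j, hj⟩
      rw [← hx, h0, mul_zero] at this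
      exact lt_irrefl _ this
    · have := hxm.2 j hj
      rw [← hx, h0, mul_zero] at this
      exact lt_irrefl _ this
  have aux : ∀ a b c : ℝ, 0 < a * b → 0 < a * c → 0 < b * c := by
    intro a b c hab hac
    have e : (a * b) * (a * c) = (a * a) * (b * c) := by ring
    have haa : 0 < a * a := mul_self_pos.2 fun h => by simp [h] at hab
    have := mul_pos hab hac
    rw [e] at this
    exact (mul_pos_iff_of_pos_left haa).1 this
  have hsub : ∀ y, y ∈ {y | (∀ j : {j // j ∈ X.1}, 0 < A.l j.1 (A.edge X j) * A.f j.1 y) ∧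
        ∀ j ∉ X.1, 0 < A.f j (A.point X) * A.f j y} → ∀ j, 0 < A.f j x * A.f j y := by
    rintro y ⟨h1, h2⟩ j
    by_cases hj : j ∈ X.1
    · exact aux _ _ _ (hxm.1 ⟨j, hj⟩) (h1 ⟨j, hj⟩)
    · exact aux _ _ _ (hxm.2 j hj) (h2 j hj)
  have hXne : Nonempty {j // j ∈ X.1} := by
    have : 0 < X.1.card := by rw [X.2]; exact A.k_pos
    obtain ⟨j, hj⟩ := Finset.card_pos.1 this
    exact ⟨⟨j, hj⟩⟩
  refine ⟨connectedComponentIn A.compl x, ⟨x, hxc, rfl⟩, ?_, ?_⟩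
  · rw [A.component_eq hxc]
    refine ⟨?_, fun hint => ?_⟩
    · rw [mem_closure_iff_seq_limit]
      have hex : ∀ n : ℕ, ∃ δ : ℝ, 0 < δ ∧ δ < 1 / ((n : ℝ) + 1) ∧
          ∀ j ∉ X.1, 0 < A.f j (A.point X) * A.f j (A.point X + δ • w) := fun n =>
        A.exists_small X w _ (by positivity)
      choose δ hδ0 hδ1 hδ2 using hex
      refine ⟨fun n => A.point X + δ n • w, fun n => hsub _ (hpt _ (hδ0 n) (hδ2 n)), ?_⟩
      have hδ : Tendsto δ atTop (𝓝 0) :=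
        squeeze_zero (fun n => (hδ0 n).le) (fun n => (hδ1 n).le)
          tendsto_one_div_add_atTop_nhds_zero_nat
      have := (hδ.smul_const w).const_add (A.point X)
      simpa using this
    · obtain ⟨j⟩ := hXne
      have := interior_subset hint j.1
      rw [A.f_point X j.2, mul_zero] at this
      exact lt_irrefl _ this
  · rw [A.component_eq hxc]
    intro y hy
    have h1 : A.f0 y - A.f0 (A.point X) = A.f0 (y - A.point X) := by rw [map_sub]
    have h2 : 0 < A.f0 (y - A.point X) := by
      rw [A.f0_eq_sum X]
      refine Finset.sum_pos (fun j _ => ?_) Finset.univ_nonempty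
      have hl : A.l j.1 (y - A.point X) = A.f j.1 y := by
        have := A.f_add j.1 (A.point X) (y - A.point X)
        rw [add_sub_cancel, A.f_point X j.2, zero_add] at this
        exact this.symm
      rw [hl]
      have h3 : 0 < A.l j.1 (A.edge X j) * A.f j.1 y :=
        aux _ _ _ (by rw [mul_comm]; exact hxm.1 j) (hy j.1)
      rw [div_eq_mul_inv]
      have h4 : 0 < (A.l j.1 (A.edge X j))⁻¹ * (A.l j.1 (A.edge X j))⁻¹ :=
        mul_self_pos.2 (inv_ne_zero (A.l_edge_self X j))
      have h5 := mul_pos h4 h3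
      have h6 : (A.l j.1 (A.edge X j))⁻¹ * (A.l j.1 (A.edge X j))⁻¹ *
          (A.l j.1 (A.edge X j) * A.f j.1 y) = A.f j.1 y * (A.l j.1 (A.edge X j))⁻¹ := by
        have := A.l_edge_self X j
        field_simp
      rwa [h6] at h5
    linarith

/-- There is exactly one domain adjacent to `X` on which `f0 > f0(X)`. -/
lemma existsUnique_isDomainAt (X : A.Vertex) : ∃! Δ, A.IsDomainAt X Δ := by
  obtain ⟨Δ, hΔ⟩ := A.exists_isDomainAt X
  exact ⟨Δ, hΔ, fun Δ' hΔ' => by rw [A.isDomainAt_signs X hΔ', ← A.isDomainAt_signs X hΔ]⟩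

/-- The domain `Δ_X`. -/
def domainAt (X : A.Vertex) : Set (Fin k → ℝ) := (A.existsUnique_isDomainAt X).choose

lemma domainAt_spec (X : A.Vertex) : A.IsDomainAt X (A.domainAt X) :=
  (A.existsUnique_isDomainAt X).choose_spec.1

/-! ### Complexification, and the branches of the integrands -/

/-- The complex-linear extension to `ℂ^k` of a linear form on `ℝ^k`. -/
def complexify (φ : (Fin k → ℝ) →ₗ[ℝ] ℝ) (z : Fin k → ℂ) : ℂ :=
  ∑ i, z i * (φ (Pi.single i 1) : ℂ)

/-- The extension of `f j` to `ℂ^k`. -/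
def fC (j : Fin N) (z : Fin k → ℂ) : ℂ := (A.f j 0 : ℂ) + complexify (A.l j) z

/-- The inclusion of `ℝ^k` in `ℂ^k`. -/
def incl (x : Fin k → ℝ) : Fin k → ℂ := fun i => (x i : ℂ)

/-- The rotation `x ↦ X + ρ (x - X)`. -/
def rotate (X : A.Vertex) (ρ : ℂ) (x : Fin k → ℝ) : Fin k → ℂ :=
  incl (A.point X) + ρ • incl (x - A.point X)

/-- The rotated cone `C_X^ρ = {X + ρ ∑ a j • e_{X \ {j}}, a j > 0}` in `ℂ^k`. -/
def rotatedCone (X : A.Vertex) (ρ : ℂ) : Set (Fin k → ℂ) := A.rotate X ρ '' A.cone X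

lemma complexify_incl (φ : (Fin k → ℝ) →ₗ[ℝ] ℝ) (x : Fin k → ℝ) :
    complexify φ (incl x) = (φ x : ℂ) := by
  have h : x = ∑ i, x i • (Pi.single i 1 : Fin k → ℝ) := pi_eq_sum_univ' x
  conv_rhs => rw [h]
  simp [complexify, incl]

lemma complexify_add (φ : (Fin k → ℝ) →ₗ[ℝ] ℝ) (z w : Fin k → ℂ) :
    complexify φ (z + w) = complexify φ z + complexify φ w := by
  simp [complexify, add_mul, Finset.sum_add_distrib]

lemma complexify_smul (φ : (Fin k → ℝ) →ₗ[ℝ] ℝ) (c : ℂ) (z : Fin k → ℂ) :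
    complexify φ (c • z) = c * complexify φ z := by
  simp [complexify, Finset.mul_sum, mul_assoc]

lemma fC_incl (j : Fin N) (x : Fin k → ℝ) : A.fC j (incl x) = (A.f j x : ℂ) := by
  have := A.f_add j 0 x
  rw [zero_add] at this
  rw [fC, complexify_incl, this, Complex.ofReal_add]

lemma fC_rotate (X : A.Vertex) (ρ : ℂ) (j : Fin N) (x : Fin k → ℝ) :
    A.fC j (A.rotate X ρ x) = (A.f j (A.point X) : ℂ) + ρ * (A.l j (x - A.point X) : ℂ) := by
  rw [← A.fC_incl, fC, fC, rotate, complexify_add, complexify_smul, complexify_incl _ (x - _),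
    add_assoc]

/-- `Φ` is a determination of `∏ j, |f j| ^ α j` around the cones `C_X^ρ`, where `|ρ| = 1` and
`Im ρ` has the sign of `σ`: it is analytic on a domain of `ℂ^k` which contains these cones and
`Δ_X` and avoids the complexified hyperplanes, and on `Δ_X` it is the real function
`∏ j, |f j| ^ α j`. Such a `Φ` is unique on the union of the cones, as they and `Δ_X` form a
connected set. -/
def IsBranch (X : A.Vertex) (σ : ℝ) (Φ : (Fin k → ℂ) → ℂ) : Prop :=
  ∃ D : Set (Fin k → ℂ), IsOpen D ∧ IsConnected D ∧ (∀ z ∈ D, ∀ j, A.fC j z ≠ 0) ∧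
    (∀ ρ : ℂ, ‖ρ‖ = 1 → 0 < σ * ρ.im → A.rotatedCone X ρ ⊆ D) ∧
    incl '' A.domainAt X ⊆ D ∧ AnalyticOnNhd ℂ Φ D ∧
    ∀ x ∈ A.domainAt X, Φ (incl x) = ((∏ j, |A.f j x| ^ A.α j : ℝ) : ℂ)

lemma analyticAt_fC (j : Fin N) (z : Fin k → ℂ) : AnalyticAt ℂ (A.fC j) z := by
  unfold fC complexify
  refine analyticAt_const.add (Finset.analyticAt_fun_sum _ fun i _ => ?_)
  exact ((ContinuousLinearMap.proj (R := ℂ) (φ := fun _ : Fin k => ℂ) i).analyticAt z).mul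
    analyticAt_const

lemma exists_isBranch (X : A.Vertex) (σ : ℝ) : ∃ Φ, A.IsBranch X σ Φ := by
  have hspec := A.domainAt_spec X
  have hsig := A.isDomainAt_signs X hspec
  obtain ⟨⟨x, hx, hΔ⟩, -, -⟩ := hspec
  have hxΔ : x ∈ A.domainAt X := by rw [hΔ]; exact mem_connectedComponentIn hx
  rw [A.component_eq hx] at hΔ
  have hxs := hxΔ
  rw [hsig] at hxs
  set s : Fin N → ℝ := fun j => Real.sign (A.f j x) with hs
  have hs_mul : ∀ j y, 0 < A.f j x * y → s j * y = |y| := by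
    intro j y h
    rcases lt_or_gt_of_ne (hx j) with h1 | h1
    · have hy : y < 0 := by nlinarith
      simp only [hs]
      rw [Real.sign_of_neg h1, abs_of_neg hy, neg_one_mul]
    · have hy : 0 < y := by nlinarith
      simp only [hs]
      rw [Real.sign_of_pos h1, abs_of_pos hy, one_mul]
  have hs0 : ∀ j, s j ≠ 0 := fun j => by
    simp only [hs]
    rw [Ne, Real.sign_eq_zero_iff]
    exact hx j
  have hslit : ∀ j, ∀ y ∈ A.domainAt X, (s j : ℂ) * A.fC j (incl y) = ((|A.f j y| : ℝ) : ℂ) ∧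
      0 < |A.f j y| := by
    intro j y hy
    rw [hΔ] at hy
    rw [A.fC_incl, ← Complex.ofReal_mul, hs_mul j _ (hy j)]
    refine ⟨rfl, abs_pos.2 fun h => ?_⟩
    have := hy j
    rw [h, mul_zero] at this
    exact lt_irrefl _ this
  set D : Set (Fin k → ℂ) := {z | ∀ j, (s j : ℂ) * A.fC j z ∈ Complex.slitPlane} with hD
  have hincl : incl '' A.domainAt X ⊆ D := by
    rintro _ ⟨y, hy, rfl⟩ j
    rw [(hslit j y hy).1, Complex.ofReal_mem_slitPlane]
    exact (hslit j y hy).2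
  have hcont : ∀ j, Continuous (A.fC j) := fun j =>
    continuous_iff_continuousAt.2 fun z => (A.analyticAt_fC j z).continuousAt
  refine ⟨fun z => ∏ j, ((s j : ℂ) * A.fC j z) ^ (A.α j : ℂ), D, ?_, ⟨⟨_, hincl ⟨x, hxΔ, rfl⟩⟩, ?_⟩,
    ?_, ?_, hincl, ?_, ?_⟩
  · rw [hD, Set.ofPred_forall]
    exact isOpen_iInter_of_finite fun j =>
      Complex.isOpen_slitPlane.preimage (continuous_const.mul (hcont j))
  · refine (StarConvex.isPathConnected (a := incl x) ?_ ?_).isConnected.isPreconnected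
    · intro z hz a b ha hb hab j
      have hstar := Complex.starConvex_ofReal_slitPlane (hslit j x hxΔ).2 (hz j) ha hb hab
      rw [← (hslit j x hxΔ).1] at hstar
      have e : (s j : ℂ) * A.fC j (a • incl x + b • z) =
          a • ((s j : ℂ) * A.fC j (incl x)) + b • ((s j : ℂ) * A.fC j z) := by
        have hab' : (a : ℂ) + b = 1 := by exact_mod_cast hab
        have e1 : a • incl x + b • z = (a : ℂ) • incl x + (b : ℂ) • z := by
          ext i; simp
        rw [e1, fC, fC, fC, complexify_add, complexify_smul, complexify_smul,
          Complex.real_smul, Complex.real_smul]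
        linear_combination (-(s j : ℂ) * (A.f j 0 : ℂ)) * hab'
      rw [e]
      exact hstar
    · exact hincl ⟨x, hxΔ, rfl⟩
  · intro z hz j h0
    have := Complex.slitPlane_ne_zero (hz j)
    rw [h0, mul_zero] at this
    exact this rfl
  · rintro ρ - hρ _ ⟨y, ⟨a, ha, hy⟩, rfl⟩ j
    have hρ0 : ρ.im ≠ 0 := fun h => by rw [h, mul_zero] at hρ; exact lt_irrefl _ hρ
    rw [A.fC_rotate]
    by_cases hl : A.l j (y - A.point X) = 0
    · have hj : j ∉ X.1 := by
        intro hj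
        rw [hy, add_sub_cancel_left, A.l_sum_edge X a ⟨j, hj⟩] at hl
        exact mul_ne_zero (ha _).ne' (A.l_edge_self X ⟨j, hj⟩) hl
      have := hxs.2 j hj
      rw [hl, Complex.ofReal_zero, mul_zero, add_zero, ← Complex.ofReal_mul,
        hs_mul j _ (by rw [mul_comm]; exact this), Complex.ofReal_mem_slitPlane]
      exact abs_pos.2 (A.f_point_ne X hj)
    · refine Complex.mem_slitPlane_iff.2 (Or.inr ?_)
      simp [hs0 j, hρ0, hl, -map_sub]
  · intro z hz
    refine Finset.analyticAt_fun_prod _ fun j _ => ?_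
    exact (analyticAt_const.mul (A.analyticAt_fC j z)).cpow analyticAt_const (hz j)
  · intro y hy
    rw [Complex.ofReal_prod]
    refine Finset.prod_congr rfl fun j _ => ?_
    rw [(hslit j y hy).1, Complex.ofReal_cpow (abs_nonneg _)]

/-- The determination of `∏ j, |f j| ^ α j` used on the cones `C_X^ρ` with `Im ρ` of the sign
of `σ`. -/
def branch (X : A.Vertex) (σ : ℝ) : (Fin k → ℂ) → ℂ := (A.exists_isBranch X σ).choose

lemma branch_spec (X : A.Vertex) (σ : ℝ) : A.IsBranch X σ (A.branch X σ) :=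
  (A.exists_isBranch X σ).choose_spec

/-! ### The integrals -/

/-- The vectors of the standard basis of `ℝ^k`, in `ℂ^k`. -/
def stdVec (s : Fin k) : Fin k → ℂ := incl (Pi.single s 1)

/-- The value of `df_{j_1} ∧ ⋯ ∧ df_{j_k}` on `(w 1, …, w k)`, for `X = {j_1 < ⋯ < j_k}`. -/
def wedge (X : A.Vertex) (w : Fin k → Fin k → ℂ) : ℂ :=
  Matrix.det (Matrix.of fun r s => complexify (A.l (X.1.orderEmbOfFin X.2 r)) (w s))

/-- The sign of `df_{j_1} ∧ ⋯ ∧ df_{j_k}` for the standard orientation,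
for `X = {j_1 < ⋯ < j_k}`. -/
def orientSign (X : A.Vertex) : ℝ :=
  Real.sign (Matrix.det (Matrix.of fun r s : Fin k =>
    A.l (X.1.orderEmbOfFin X.2 r) (Pi.single s (1 : ℝ))))

/-- The value at `z` of the `k`-form `ω_X = df_{j_1} / f_{j_1} ∧ ⋯ ∧ df_{j_k} / f_{j_k}` on
`(w 1, …, w k)`, with `X = {j_1, …, j_k}` ordered so that `df_{j_1} ∧ ⋯ ∧ df_{j_k}` is
positively oriented. -/
def omega (X : A.Vertex) (z : Fin k → ℂ) (w : Fin k → Fin k → ℂ) : ℂ :=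
  (∏ j ∈ X.1, A.fC j z)⁻¹ * ((A.orientSign X : ℂ) * A.wedge X w)

/-- The density on `ℝ^k` of the form `e^{-λ f0} (∏ j, |f j| ^ α j) ω_X`. -/
def domainIntegrand (lam : ℂ) (X : A.Vertex) (x : Fin k → ℝ) : ℂ :=
  Complex.exp (-lam * (A.f0 x : ℂ)) * ((∏ j, |A.f j x| ^ A.α j : ℝ) : ℂ) *
    A.omega X (incl x) stdVec

/-- The vector `I_Δ(λ)`, with components `∫_Δ e^{-λ f0} (∏ j, |f j| ^ α j) ω_X`. -/
def integralDomain (Δ : Set (Fin k → ℝ)) (lam : ℂ) : A.Vertex → ℂ :=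
  fun X => ∫ x in Δ, A.domainIntegrand lam X x

/-- The density on the cone `C_X^+` of the pullback under `x ↦ X + ρ (x - X)` of the form
`e^{-λ f0} (∏ j, |f j| ^ α j) ω_{X'}` on `C_X^ρ`, for `ρ` not real. -/
def coneIntegrand (X : A.Vertex) (ρ lam : ℂ) (X' : A.Vertex) (x : Fin k → ℝ) : ℂ :=
  Complex.exp (-lam * complexify A.f0 (A.rotate X ρ x)) *
    A.branch X (Real.sign ρ.im) (A.rotate X ρ x) *
    A.omega X' (A.rotate X ρ x) fun s => ρ • stdVec s

/-- The vector `I_X^ρ(λ)`, with components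
`∫_{C_X^ρ} e^{-λ f0} (∏ j, |f j| ^ α j) ω_{X'}`. -/
def integralCone (X : A.Vertex) (ρ lam : ℂ) : A.Vertex → ℂ :=
  fun X' => ∫ x in A.cone X, A.coneIntegrand X ρ lam X' x

/-- The vector `I_X^+(λ)`: the common value of `I_X^ρ(λ)` for `|ρ| = 1`, `Im ρ < 0` and
`Re (ρ λ) > 0`. -/
def integralPlus (X : A.Vertex) (lam : ℂ) : A.Vertex → ℂ :=
  Classical.epsilon fun c =>
    ∀ ρ : ℂ, ‖ρ‖ = 1 → ρ.im < 0 → 0 < (ρ * lam).re → A.integralCone X ρ lam = c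

/-- The vector `I_X^-(λ)`: the common value of `I_X^ρ(λ)` for `|ρ| = 1`, `Im ρ > 0` and
`Re (ρ λ) > 0`. -/
def integralMinus (X : A.Vertex) (lam : ℂ) : A.Vertex → ℂ :=
  Classical.epsilon fun c =>
    ∀ ρ : ℂ, ‖ρ‖ = 1 → 0 < ρ.im → 0 < (ρ * lam).re → A.integralCone X ρ lam = c

/-! ### The coefficients -/

open Classical in
/-- The (indices of the) hyperplanes that separate `Δ` from `Δ'`. -/
def separating (Δ Δ' : Set (Fin k → ℝ)) : Finset (Fin N) :=
  {j | ∀ x ∈ Δ, ∀ y ∈ Δ', A.f j x * A.f j y < 0}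

/-- `α_U = ∑ j ∈ U, α j`. -/
def weight (U : Finset (Fin N)) : ℝ := ∑ j ∈ U, A.α j

open Classical in
/-- The coefficient `ψ(Δ, X)`. -/
def psi (Δ : Set (Fin k → ℝ)) (X : A.Vertex) : ℂ :=
  if Δ = A.domainAt X then 1
  else (-1) ^ (A.separating Δ (A.domainAt X)).card *
    Complex.exp (Complex.I * Real.pi * A.weight (A.separating Δ (A.domainAt X)))

open Classical in
/-- The vertices in the boundary of `Δ`. -/
def boundaryVertices (Δ : Set (Fin k → ℝ)) : Finset A.Vertex :=
  {X | A.point X ∈ frontier Δ}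

end Arrangement

end

namespace Arrangement

variable {k N : ℕ} (A : Arrangement k N)

/-! The real domain is written as a signed combination of the real cones at its vertices, and each
cone is then turned into `ℂ^k`.

Decomposition. Off the hyperplanes, the indicator function of `Δ` is the sum, over its vertices `X`,
of `(-1) ^ |H(Δ, Δ_X)|` times the indicator function of `C_X^+` (`sum_indicator_cone`). Let `S` be
the set of hyperplanes having `x` and `Δ` on opposite sides. The hyperplanes separating `Δ` from
`Δ_X` are the `j ∈ X` whose edge, followed into the side of `Δ`, decreases `f0` (`descending`), and
`x` lies in `C_X^+` exactly when this set is `X ∩ S`. An alternating sum over the sets `T` between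
these two turns the signed count into the sum of `(-1) ^ |T|` over the `T ⊆ S` that cut out a
nonempty face of the closed polyhedron, because each such face has exactly one vertex whose
descending edges all have index in `T`: the minimum of `f0` on the face (`existsUnique_isOptimal`,
`sum_descending_eq`). Hence any other generic linear form bounded below on the polyhedron gives the
same count. If `j₀ ∈ S`, a small perturbation of `± l j₀` takes at `x` a value below all its values
on the polyhedron, so that no vertex contributes and the count is `0` (`sum_descending_eq_zero`). If
`S` is empty, only `T = ∅` remains and the count is `1`.

Rotation. Let `ρ` be replaced by any `t` with `Re t > 0` and `Im t` of the sign of `σ`. The integral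
is holomorphic in `t`, and it is unchanged when `t` is multiplied by a positive real number, since
the cone is invariant under dilations; so its derivative vanishes and it is constant
(`integral_scaledIntegrand_eq`). Letting `t → 1` inside the quadrant gives the integral over the
real cone of the real density times `phase`: each form whose sign at `x` differs from that on `Δ_X`
contributes `exp (-iσπα_j)` (`integral_scaledIntegrand_eq_phase`). Convergence and both passages to
the limit rest on the uniform bound `exists_bound`.

Assembly. The decomposition is multiplied by the real density times the phase measured from `Δ`,
which is `1` on `Δ`. On `C_X^+` this phase is the one measured from `Δ_X` times the exponential
factor of `ψ(Δ, X)` or of its conjugate (`exp_weight_mul_phase`). Integration gives the expansion in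
the `I_X^+` for `σ = -1` and in the `I_X^-` for `σ = 1`. -/

lemma f_sub (j : Fin N) (x y : Fin k → ℝ) : A.l j (x - y) = A.f j x - A.f j y := by
  have := A.f_add j y (x - y)
  rw [add_sub_cancel] at this
  linarith

lemma l_sub_point (X : A.Vertex) {j : Fin N} (hj : j ∈ X.1) (x : Fin k → ℝ) :
    A.l j (x - A.point X) = A.f j x := by
  rw [A.f_sub, A.f_point X hj, sub_zero]

lemma nonempty_vertex (X : A.Vertex) : Nonempty {j // j ∈ X.1} := by
  have : 0 < X.1.card := by rw [X.2]; exact A.k_pos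
  obtain ⟨j, hj⟩ := Finset.card_pos.1 this
  exact ⟨⟨j, hj⟩⟩

lemma exists_vertex_superset (U : Finset (Fin N)) (hU : U.card ≤ k) :
    ∃ X : A.Vertex, U ⊆ X.1 := by
  obtain ⟨X, h1, h2⟩ := Finset.exists_superset_card_eq hU
    (by simpa using A.k_le)
  exact ⟨⟨X, h2⟩, h1⟩

lemma l_ne_zero (j : Fin N) : A.l j ≠ 0 := by
  obtain ⟨X, hX⟩ := A.exists_vertex_superset {j} (by rw [Finset.card_singleton]; exact A.k_pos)
  have hj : j ∈ X.1 := hX (by simp)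
  intro h
  have := A.l_edge_self X ⟨j, hj⟩
  simp [h] at this

/-- The hyperplanes through a point are at most `k` in number. -/
lemma card_active_le (y : Fin k → ℝ) : (Finset.univ.filter fun j => A.f j y = 0).card ≤ k := by
  by_contra h
  push Not at h
  obtain ⟨Y, hY, hc⟩ := Finset.exists_subset_card_eq (Nat.succ_le_of_lt h)
  exact A.inter_succ Y hc ⟨y, fun j hj => (Finset.mem_filter.1 (hY hj)).2⟩

lemma eq_point (X : A.Vertex) (y : Fin k → ℝ) (hy : ∀ j ∈ X.1, A.f j y = 0) :
    y = A.point X :=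
  (A.inter_k X.1 X.2).choose_spec.2 y hy

lemma point_injective : Function.Injective A.point := by
  intro X Y h
  apply Subtype.ext
  by_contra hne
  exact A.f0_vertices X.1 Y.1 X.2 Y.2 hne (A.point X) (A.point Y) (fun j hj => A.f_point X hj)
    (fun j hj => A.f_point Y hj) (by rw [h])

/-! ### Domains as chambers of prescribed signs -/

/-- The set of points at which the forms `f j` have the strict signs `s j`. -/
def chamber (s : Fin N → ℝ) : Set (Fin k → ℝ) := {y | ∀ j, 0 < s j * A.f j y}

lemma isOpen_chamber (s : Fin N → ℝ) : IsOpen (A.chamber s) := by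
  rw [chamber, Set.ofPred_forall]
  exact isOpen_iInter_of_finite fun j =>
    isOpen_lt continuous_const (continuous_const.mul (A.continuous_f j))

/-- With signs normalized to `±1`, separation by `H j` becomes the inequality `s j ≠ s' j`. -/
lemma exists_signs {Δ : Set (Fin k → ℝ)} (h : Δ ∈ A.domains) :
    ∃ s : Fin N → ℝ, (∀ j, s j = 1 ∨ s j = -1) ∧ Δ = A.chamber s ∧ Δ.Nonempty := by
  obtain ⟨x, hx, rfl⟩ := h
  refine ⟨fun j => Real.sign (A.f j x), fun j => ?_, ?_, ⟨x, mem_connectedComponentIn hx⟩⟩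
  · rcases lt_or_gt_of_ne (hx j) with h | h
    · right; exact Real.sign_of_neg h
    · left; exact Real.sign_of_pos h
  · rw [A.component_eq hx]
    ext y
    refine forall_congr' fun j => ?_
    rcases lt_or_gt_of_ne (hx j) with h | h
    · simp only [Real.sign_of_neg h]
      constructor <;> intro h' <;> nlinarith
    · simp only [Real.sign_of_pos h]
      constructor <;> intro h' <;> nlinarith

/-- The sign of `f j` on `Δ_X`. -/
noncomputable def side (X : A.Vertex) (j : Fin N) : ℝ :=
  if h : j ∈ X.1 then Real.sign (A.l j (A.edge X ⟨j, h⟩)) else Real.sign (A.f j (A.point X))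

lemma sign_eq_or {r : ℝ} (h : r ≠ 0) : Real.sign r = 1 ∨ Real.sign r = -1 := by
  rcases lt_or_gt_of_ne h with h | h
  · right; exact Real.sign_of_neg h
  · left; exact Real.sign_of_pos h

lemma sign_mul_pos_iff {r t : ℝ} (h : r ≠ 0) : 0 < Real.sign r * t ↔ 0 < r * t := by
  rcases lt_or_gt_of_ne h with h | h
  · rw [Real.sign_of_neg h]; constructor <;> intro h' <;> nlinarith
  · rw [Real.sign_of_pos h]; constructor <;> intro h' <;> nlinarith

lemma side_eq_or (X : A.Vertex) (j : Fin N) : A.side X j = 1 ∨ A.side X j = -1 := by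
  unfold side
  split_ifs with h
  · exact sign_eq_or (A.l_edge_self X ⟨j, h⟩)
  · exact sign_eq_or (A.f_point_ne X h)

lemma side_mul_pos_of_mem (X : A.Vertex) {j : Fin N} (h : j ∈ X.1) (t : ℝ) :
    0 < A.side X j * t ↔ 0 < A.l j (A.edge X ⟨j, h⟩) * t := by
  rw [side, dif_pos h, sign_mul_pos_iff (A.l_edge_self X ⟨j, h⟩)]

lemma side_mul_pos_of_notMem (X : A.Vertex) {j : Fin N} (h : j ∉ X.1) (t : ℝ) :
    0 < A.side X j * t ↔ 0 < A.f j (A.point X) * t := by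
  rw [side, dif_neg h, sign_mul_pos_iff (A.f_point_ne X h)]

lemma side_mul_point_pos (X : A.Vertex) {j : Fin N} (h : j ∉ X.1) :
    0 < A.side X j * A.f j (A.point X) := by
  rw [A.side_mul_pos_of_notMem X h]
  exact mul_self_pos.2 (A.f_point_ne X h)

lemma domainAt_eq (X : A.Vertex) : A.domainAt X = A.chamber (A.side X) := by
  rw [A.isDomainAt_signs X (A.domainAt_spec X)]
  ext y
  constructor
  · rintro ⟨h1, h2⟩ j
    by_cases hj : j ∈ X.1
    · exact (A.side_mul_pos_of_mem X hj _).2 (h1 ⟨j, hj⟩)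
    · exact (A.side_mul_pos_of_notMem X hj _).2 (h2 j hj)
  · intro h
    exact ⟨fun j => (A.side_mul_pos_of_mem X j.2 _).1 (h j),
      fun j hj => (A.side_mul_pos_of_notMem X hj _).1 (h j)⟩

lemma domainAt_nonempty (X : A.Vertex) : (A.domainAt X).Nonempty := by
  obtain ⟨⟨x, hx, h⟩, -⟩ := A.domainAt_spec X
  exact ⟨x, h ▸ mem_connectedComponentIn hx⟩

/-- In the basis of the edges at `X`, the coordinate of `x - X` along the edge `j` is `f j x / l j
(edge X j)`. -/
lemma mem_cone_iff (X : A.Vertex) (x : Fin k → ℝ) :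
    x ∈ A.cone X ↔ ∀ j ∈ X.1, 0 < A.side X j * A.f j x := by
  constructor
  · rintro ⟨a, ha, rfl⟩ j hj
    rw [A.side_mul_pos_of_mem X hj, A.f_add, A.f_point X hj, zero_add, A.l_sum_edge X a ⟨j, hj⟩]
    have := mul_self_pos.2 (A.l_edge_self X ⟨j, hj⟩)
    have := mul_pos (ha ⟨j, hj⟩) this
    linarith
  · intro h
    refine ⟨fun j => A.l j.1 (x - A.point X) / A.l j.1 (A.edge X j), fun j => ?_, ?_⟩
    · beta_reduce
      rw [A.l_sub_point X j.2]
      have := (A.side_mul_pos_of_mem X j.2 _).1 (h j.1 j.2)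
      rcases mul_pos_iff.1 this with ⟨h1, h2⟩ | ⟨h1, h2⟩
      · exact div_pos h2 h1
      · exact div_pos_of_neg_of_neg h2 h1
    · rw [← A.eq_sum_edge X (x - A.point X), add_sub_cancel]

lemma isOpen_cone (X : A.Vertex) : IsOpen (A.cone X) := by
  have : A.cone X = ⋂ j ∈ X.1, {x | 0 < A.side X j * A.f j x} := by
    ext x
    simp [A.mem_cone_iff]
  rw [this]
  exact isOpen_biInter_finset fun j _ =>
    isOpen_lt continuous_const (continuous_const.mul (A.continuous_f j))

/-- The points of the cone, in polar coordinates. -/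
lemma smul_mem_cone (X : A.Vertex) {x : Fin k → ℝ} {r : ℝ} (hr : 0 < r) :
    A.point X + r • (x - A.point X) ∈ A.cone X ↔ x ∈ A.cone X := by
  rw [A.mem_cone_iff, A.mem_cone_iff]
  refine forall₂_congr fun j hj => ?_
  rw [A.f_add, A.f_point X hj, zero_add, map_smul, A.l_sub_point X hj, smul_eq_mul,
    mul_left_comm, mul_pos_iff_of_pos_left hr]

/-- Near `X` only the hyperplanes through `X` can change sign, and these are independent, so that
all their sign patterns occur arbitrarily close to `X`. -/
lemma mem_frontier_chamber (s : Fin N → ℝ) (hs : ∀ j, s j = 1 ∨ s j = -1) (X : A.Vertex) :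
    A.point X ∈ frontier (A.chamber s) ↔ ∀ j ∉ X.1, 0 < s j * A.f j (A.point X) := by
  have hs0 : ∀ j, s j ≠ 0 := fun j => by rcases hs j with h | h <;> rw [h] <;> norm_num
  rw [(A.isOpen_chamber s).frontier_eq]
  constructor
  · rintro ⟨h, -⟩ j hj
    have hcl : A.point X ∈ {y | 0 ≤ s j * A.f j y} := by
      have hclosed : IsClosed {y | 0 ≤ s j * A.f j y} :=
        isClosed_le continuous_const (continuous_const.mul (A.continuous_f j))
      exact hclosed.closure_subset_iff.2 (fun y hy => (hy j).le) h
    exact lt_of_le_of_ne hcl (mul_ne_zero (hs0 j) (A.f_point_ne X hj)).symm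
  · intro h
    refine ⟨?_, fun hX => ?_⟩
    -- The coefficients are chosen so that `s j * l j w = (s j * l j (edge X j)) ^ 2 > 0` for all `j
    -- ∈ X`: the vector `w` points into the chamber.
    · set w : Fin k → ℝ := ∑ j : {j // j ∈ X.1}, (s j.1 * A.l j.1 (A.edge X j)) • A.edge X j
        with hw
      rw [Metric.mem_closure_iff]
      intro ε hε
      obtain ⟨δ, hδ, hδ', hs⟩ := A.exists_small X w (ε / (‖w‖ + 1)) (by positivity)
      refine ⟨A.point X + δ • w, fun j => ?_, ?_⟩
      · by_cases hj : j ∈ X.1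
        · rw [A.f_add, A.f_point X hj, zero_add, map_smul, hw, A.l_sum_edge X _ ⟨j, hj⟩,
            smul_eq_mul]
          have h1 := mul_self_pos.2 (mul_ne_zero (hs0 j) (A.l_edge_self X ⟨j, hj⟩))
          nlinarith [mul_pos hδ h1]
        · have h1 := hs j hj
          have h2 := h j hj
          rcases mul_pos_iff.1 h1 with ⟨h3, h4⟩ | ⟨h3, h4⟩
          · exact mul_pos (pos_of_mul_pos_left h2 h3.le) h4
          · exact mul_pos_of_neg_of_neg (by nlinarith) h4
      · rw [dist_eq_norm, sub_add_cancel_left, norm_neg, norm_smul, Real.norm_of_nonneg hδ.le]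
        rw [lt_div_iff₀ (by positivity)] at hδ'
        nlinarith [norm_nonneg w]
    · obtain ⟨j⟩ := A.nonempty_vertex X
      have := hX j.1
      rw [A.f_point X j.2, mul_zero] at this
      exact lt_irrefl _ this

lemma mem_separating_chamber (s s' : Fin N → ℝ) (hs : ∀ j, s j = 1 ∨ s j = -1)
    (hs' : ∀ j, s' j = 1 ∨ s' j = -1) (h : (A.chamber s).Nonempty) (h' : (A.chamber s').Nonempty)
    (j : Fin N) : j ∈ separating A (A.chamber s) (A.chamber s') ↔ s j ≠ s' j := by
  obtain ⟨x, hx⟩ := h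
  obtain ⟨y, hy⟩ := h'
  unfold separating
  simp only [Finset.mem_filter, Finset.mem_univ, true_and]
  constructor
  · intro h e
    have h1 := h x hx y hy
    have h2 := mul_pos (hx j) (hy j)
    rw [e] at h2
    nlinarith [mul_self_nonneg (s' j)]
  · intro h z hz w hw
    have h1 := hz j
    have h2 := hw j
    rcases hs j with e | e <;> rcases hs' j with e' | e' <;> rw [e] at h1 h <;> rw [e'] at h2 h
    · exact absurd rfl h
    · nlinarith
    · nlinarith
    · exact absurd rfl h

/-- The hyperplanes separating a domain from `Δ_X`, for a vertex `X` of the domain, pass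
through `X`. -/
lemma side_eq_of_notMem (s : Fin N → ℝ) (hs : ∀ j, s j = 1 ∨ s j = -1) (X : A.Vertex)
    {j : Fin N} (hj : j ∉ X.1) (h : 0 < s j * A.f j (A.point X)) : s j = A.side X j := by
  have h1 := A.side_mul_point_pos X hj
  rcases hs j with e | e <;> rcases A.side_eq_or X j with e' | e' <;> rw [e] at h <;>
    rw [e'] at h1 <;> rw [e, e'] <;> linarith

/-- The case distinction in `psi` is redundant, because no hyperplane separates a nonempty domain
from itself. -/
lemma psi_eq (Δ : Set (Fin k → ℝ)) (X : A.Vertex) :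
    A.psi Δ X = (-1) ^ (separating A Δ (A.domainAt X)).card *
      Complex.exp (Complex.I * Real.pi * A.weight (separating A Δ (A.domainAt X))) := by
  rw [psi]
  split_ifs with h
  · have : separating A Δ (A.domainAt X) = ∅ := by
      ext j
      rw [h, A.domainAt_eq, A.mem_separating_chamber _ _ (A.side_eq_or X) (A.side_eq_or X)]
      · simp
      all_goals rw [← A.domainAt_eq]; exact A.domainAt_nonempty X
    rw [this]
    simp [weight]
  · rfl

/-! ### Linear optimization on the faces of a domain -/

/-- The closed polyhedron on which the forms `f j` have the signs `s j`. -/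
def polyhedron (s : Fin N → ℝ) : Set (Fin k → ℝ) := {y | ∀ j, 0 ≤ s j * A.f j y}

lemma map_eq_sum (X : A.Vertex) (g : (Fin k → ℝ) →ₗ[ℝ] ℝ) (v : Fin k → ℝ) :
    g v = ∑ j : {j // j ∈ X.1}, A.l j.1 v / A.l j.1 (A.edge X j) * g (A.edge X j) := by
  conv_lhs => rw [A.eq_sum_edge X v]
  rw [map_sum]
  exact Finset.sum_congr rfl fun j _ => by rw [map_smul, smul_eq_mul]

lemma map_sub_point_eq_sum (X : A.Vertex) (g : (Fin k → ℝ) →ₗ[ℝ] ℝ) (y : Fin k → ℝ) :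
    g y - g (A.point X) =
      ∑ j : {j // j ∈ X.1}, A.f j.1 y / A.l j.1 (A.edge X j) * g (A.edge X j) := by
  rw [← map_sub, A.map_eq_sum X g]
  exact Finset.sum_congr rfl fun j _ => by rw [A.l_sub_point X j.2]

/-- Each term of the expansion of `g y - g X` is, up to a positive factor, a slack `s j * f j y`,
nonnegative on the polyhedron, times a reduced cost, whose sign tells whether `g` increases along
the edge `j` followed into the side `s j`. -/
lemma reduced_cost_eq (s : Fin N → ℝ) (hs : ∀ j, s j = 1 ∨ s j = -1) (X : A.Vertex)
    (g : (Fin k → ℝ) →ₗ[ℝ] ℝ) (j : {j // j ∈ X.1}) (y : Fin k → ℝ) :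
    A.f j.1 y / A.l j.1 (A.edge X j) * g (A.edge X j) =
      (s j.1 * A.f j.1 y) * (s j.1 * A.l j.1 (A.edge X j) * g (A.edge X j)) /
        (A.l j.1 (A.edge X j)) ^ 2 := by
  have h := A.l_edge_self X j
  rcases hs j.1 with e | e <;> rw [e] <;> field_simp

/-- From any point of a face on which `g` is bounded below one descends to a vertex. -/
lemma exists_vertex_le (s : Fin N → ℝ) (hs : ∀ j, s j = 1 ∨ s j = -1)
    (g : (Fin k → ℝ) →ₗ[ℝ] ℝ) (hg : ∀ X j, g (A.edge X j) ≠ 0) (m : ℝ)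
    (hm : ∀ y ∈ A.polyhedron s, m ≤ g y) (y : Fin k → ℝ) (hy : y ∈ A.polyhedron s) :
    ∃ X : A.Vertex, A.point X ∈ A.polyhedron s ∧ (∀ j, A.f j y = 0 → j ∈ X.1) ∧
      g (A.point X) ≤ g y := by
  -- Induction on the number of hyperplanes still missing: each step makes one more form vanish.
  induction hn : k - (Finset.univ.filter fun j => A.f j y = 0).card using Nat.strong_induction_on
    generalizing y with
  | _ n ih =>
  have hs0 : ∀ j, s j ≠ 0 := fun j => by rcases hs j with h | h <;> rw [h] <;> norm_num
  set U := Finset.univ.filter fun j => A.f j y = 0 with hU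
  have hUmem : ∀ j, j ∈ U ↔ A.f j y = 0 := fun j => by simp [hU]
  rcases (A.card_active_le y).eq_or_lt with hc | hc
  · refine ⟨⟨U, hc⟩, ?_, fun j hj => (hUmem j).2 hj, ?_⟩
    all_goals
      have := A.eq_point ⟨U, hc⟩ y fun j hj => (hUmem j).1 hj
      rw [← this]
    · exact hy
  · obtain ⟨X, hX⟩ := A.exists_vertex_superset U hc.le
    obtain ⟨j, hjX, hjU⟩ : ∃ j ∈ X.1, j ∉ U := by
      by_contra hcon
      push Not at hcon
      have := Finset.card_le_card hcon
      rw [X.2] at this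
      exact absurd hc (not_lt.2 this)
    -- An edge of `X` that lies in all the active hyperplanes, directed so that `g` decreases along
    -- it.
    obtain ⟨v, hlv, hgv⟩ : ∃ v, (∀ i ∈ U, A.l i v = 0) ∧ g v < 0 := by
      have hl : ∀ i ∈ U, A.l i (A.edge X ⟨j, hjX⟩) = 0 := fun i hi =>
        A.l_edge X ⟨j, hjX⟩ (hX hi) fun h => hjU (by rw [show j = i from h.symm]; exact hi)
      rcases lt_or_gt_of_ne (hg X ⟨j, hjX⟩) with h | h
      · exact ⟨_, hl, h⟩
      · exact ⟨-A.edge X ⟨j, hjX⟩, fun i hi => by rw [map_neg, hl i hi, neg_zero],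
          by rw [map_neg]; linarith⟩
    set V := Finset.univ.filter fun i => s i * A.l i v < 0 with hV
    have hVmem : ∀ i, i ∈ V ↔ s i * A.l i v < 0 := fun j => by simp [hV]
    have hVne : V.Nonempty := by
      by_contra hcon
      rw [Finset.not_nonempty_iff_eq_empty] at hcon
      have hnn : ∀ i, 0 ≤ s i * A.l i v := fun i => by
        by_contra h
        have := (hVmem i).2 (not_le.1 h)
        rw [hcon] at this
        simp at this
      -- If no slack decreases along `v`, the whole ray stays in the polyhedron; at this parameter
      -- `g` would take the value `m - 1`.
      have ht : 0 ≤ (g y - m + 1) / (-g v) :=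
        div_nonneg (by linarith [hm y hy]) (by linarith)
      have := hm (y + ((g y - m + 1) / (-g v)) • v) fun i => by
        rw [A.f_add, map_smul, smul_eq_mul]
        have h1 := hy i
        have h2 := mul_nonneg ht (hnn i)
        nlinarith
      rw [map_add, map_smul, smul_eq_mul] at this
      have e : (g y - m + 1) / (-g v) * g v = -(g y - m + 1) := by
        rw [div_neg, neg_mul, div_mul_cancel₀ _ hgv.ne]
      rw [e] at this
      linarith
    -- The ratio test: the minimal ratio is the largest step that keeps all slacks nonnegative, and
    -- it makes `f i` vanish.
    obtain ⟨i, hi, hmin⟩ := V.exists_min_image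
      (fun i => (s i * A.f i y) / (-(s i * A.l i v))) hVne
    set t := (s i * A.f i y) / (-(s i * A.l i v)) with ht
    have hiV := (hVmem i).1 hi
    have ht0 : 0 ≤ t := div_nonneg (hy i) (by linarith)
    have hyt : y + t • v ∈ A.polyhedron s := by
      intro r
      rw [A.f_add, map_smul, smul_eq_mul]
      by_cases hr : s r * A.l r v < 0
      · have := hmin r ((hVmem r).2 hr)
        rw [le_div_iff₀ (by linarith)] at this
        change t * _ ≤ _ at this
        linarith
      · have := mul_nonneg ht0 (not_lt.1 hr)
        have := hy r
        nlinarith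
    have hUsub : ∀ r, A.f r y = 0 → A.f r (y + t • v) = 0 := by
      intro r hr
      rw [A.f_add, map_smul, hlv r ((hUmem r).2 hr), hr, smul_zero, add_zero]
    have hii : A.f i (y + t • v) = 0 := by
      rw [A.f_add, map_smul, smul_eq_mul, ht]
      have h1 : A.l i v ≠ 0 := fun h => by rw [h, mul_zero] at hiV; exact lt_irrefl _ hiV
      have := hs0 i
      field_simp
      ring
    have hiU : i ∉ U := fun h => by
      rw [hlv i h, mul_zero] at hiV
      exact lt_irrefl _ hiV
    have hlt : U.card < (Finset.univ.filter fun j => A.f j (y + t • v) = 0).card := by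
      refine Finset.card_lt_card ((Finset.ssubset_iff_of_subset ?_).2 ⟨i, by simpa using hii, hiU⟩)
      intro r hr
      simpa using hUsub r ((hUmem r).1 hr)
    obtain ⟨Y, h1, h2, h3⟩ := ih _ (by rw [← hU] at hc; omega) (y + t • v) hyt rfl
    refine ⟨Y, h1, fun r hr => h2 r (hUsub r hr), h3.trans ?_⟩
    rw [map_add, map_smul, smul_eq_mul]
    nlinarith

/-- A vertex of a face at which the reduced costs of `g` are positive is the only minimum
of `g` on the face. -/
lemma lt_of_isOptimal (s : Fin N → ℝ) (hs : ∀ j, s j = 1 ∨ s j = -1)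
    (g : (Fin k → ℝ) →ₗ[ℝ] ℝ) (T : Finset (Fin N)) (X : A.Vertex)
    (hX : ∀ j : {j // j ∈ X.1}, j.1 ∉ T → 0 < s j.1 * A.l j.1 (A.edge X j) * g (A.edge X j))
    (y : Fin k → ℝ) (hy : y ∈ A.polyhedron s) (hyT : ∀ j ∈ T, A.f j y = 0)
    (hne : y ≠ A.point X) : g (A.point X) < g y := by
  rw [← sub_pos, A.map_sub_point_eq_sum X]
  refine Finset.sum_pos' (fun j _ => ?_) ?_
  · by_cases hj : j.1 ∈ T
    · rw [hyT j.1 hj, zero_div, zero_mul]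
    · rw [A.reduced_cost_eq s hs]
      exact div_nonneg (mul_nonneg (hy j.1) (hX j hj).le) (sq_nonneg _)
  · obtain ⟨j, hj, hj0⟩ : ∃ j ∈ X.1, A.f j y ≠ 0 := by
      by_contra hcon
      push Not at hcon
      exact hne (A.eq_point X y hcon)
    have hjT : j ∉ T := fun h => hj0 (hyT j h)
    refine ⟨⟨j, hj⟩, Finset.mem_univ _, ?_⟩
    rw [A.reduced_cost_eq s hs X g ⟨j, hj⟩]
    have hs0 : s j ≠ 0 := by rcases hs j with e | e <;> rw [e] <;> norm_num
    exact div_pos (mul_pos (lt_of_le_of_ne (hy j) (mul_ne_zero hs0 hj0).symm) (hX ⟨j, hj⟩ hjT))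
      (sq_pos_of_ne_zero (A.l_edge_self X ⟨j, hj⟩))

/-- Each nonempty face has exactly one vertex at which the reduced costs are positive. -/
lemma existsUnique_isOptimal (s : Fin N → ℝ) (hs : ∀ j, s j = 1 ∨ s j = -1)
    (g : (Fin k → ℝ) →ₗ[ℝ] ℝ) (hg : ∀ X j, g (A.edge X j) ≠ 0) (m : ℝ)
    (hm : ∀ y ∈ A.polyhedron s, m ≤ g y) (T : Finset (Fin N))
    (hT : ∃ y ∈ A.polyhedron s, ∀ j ∈ T, A.f j y = 0) :
    ∃! X : A.Vertex, A.point X ∈ A.polyhedron s ∧ T ⊆ X.1 ∧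
      ∀ j : {j // j ∈ X.1}, j.1 ∉ T → 0 < s j.1 * A.l j.1 (A.edge X j) * g (A.edge X j) := by
  classical
  obtain ⟨y, hy, hyT⟩ := hT
  set W : Finset A.Vertex := Finset.univ.filter fun X => A.point X ∈ A.polyhedron s ∧ T ⊆ X.1
    with hW
  have hWmem : ∀ X, X ∈ W ↔ A.point X ∈ A.polyhedron s ∧ T ⊆ X.1 := fun X => by simp [hW]
  have hWne : W.Nonempty := by
    obtain ⟨X, h1, h2, -⟩ := A.exists_vertex_le s hs g hg m hm y hy
    exact ⟨X, (hWmem X).2 ⟨h1, fun j hj => h2 j (hyT j hj)⟩⟩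
  -- The optimal vertex is the minimum of `g` among the finitely many vertices of the face.
  obtain ⟨X, hXW, hmin⟩ := W.exists_min_image (fun X => g (A.point X)) hWne
  obtain ⟨hXP, hTX⟩ := (hWmem X).1 hXW
  refine ⟨X, ⟨hXP, hTX, ?_⟩, ?_⟩
  · intro j hjT
    by_contra hneg
    have hs0 : ∀ j, s j ≠ 0 := fun j => by rcases hs j with h | h <;> rw [h] <;> norm_num
    have hlt : s j.1 * A.l j.1 (A.edge X j) * g (A.edge X j) < 0 :=
      lt_of_le_of_ne (not_lt.1 hneg)
        (mul_ne_zero (mul_ne_zero (hs0 _) (A.l_edge_self X j)) (hg X j))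
    -- This multiple of the edge points into the polyhedron, stays on the face since `j ∉ T`, and
    -- decreases `g`; descending from a nearby point of it reaches a vertex of the face below the
    -- minimum.
    set w : Fin k → ℝ := (s j.1 * A.l j.1 (A.edge X j)) • A.edge X j with hw
    obtain ⟨ε, hε, -, hsm⟩ := A.exists_small X w 1 one_pos
    have hP : A.point X + ε • w ∈ A.polyhedron s := by
      intro i
      by_cases hi : i ∈ X.1
      · rw [A.f_add, A.f_point X hi, zero_add, map_smul, hw, map_smul, smul_eq_mul, smul_eq_mul]
        by_cases hij : i = j.1
        · subst hij
          nlinarith [mul_nonneg hε.le (mul_self_nonneg (s j.1 * A.l j.1 (A.edge X j)))]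
        · rw [A.l_edge X j hi hij]
          simp
      · have h1 := hsm i hi
        have h2 := hXP i
        rcases mul_pos_iff.1 h1 with ⟨h3, h4⟩ | ⟨h3, h4⟩
        · exact mul_nonneg (nonneg_of_mul_nonneg_left h2 h3) h4.le
        · exact mul_nonneg_of_nonpos_of_nonpos (by nlinarith) h4.le
    have hT' : ∀ i ∈ T, A.f i (A.point X + ε • w) = 0 := by
      intro i hi
      have hij : i ≠ j.1 := fun h => hjT (h ▸ hi)
      rw [A.f_add, A.f_point X (hTX hi), zero_add, map_smul, hw, map_smul,
        A.l_edge X j (hTX hi) hij, smul_zero, smul_zero]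
    obtain ⟨Y, h1, h2, h3⟩ := A.exists_vertex_le s hs g hg m hm _ hP
    have h4 := hmin Y ((hWmem Y).2 ⟨h1, fun i hi => h2 i (hT' i hi)⟩)
    have h5 := h4.trans h3
    rw [map_add, map_smul, hw, map_smul, smul_eq_mul, smul_eq_mul] at h5
    nlinarith [mul_neg_of_pos_of_neg hε hlt]
  · rintro Y ⟨hYP, hTY, hY⟩
    have h1 := hmin Y ((hWmem Y).2 ⟨hYP, hTY⟩)
    by_contra hne
    have hXY : A.point X ≠ A.point Y := fun h => hne (A.point_injective h.symm)
    exact absurd h1 (not_le.2 (A.lt_of_isOptimal s hs g T Y hY _ hXP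
      (fun j hj => A.f_point X (hTX hj)) hXY))

/-! ### The indicator function of a domain as a signed sum over cones -/

/-- An alternating sum over an interval of finite sets. -/
lemma sum_interval_neg_one_pow {ι : Type*} [DecidableEq ι] (S B C : Finset ι) (hC : C ⊆ S) :
    (∑ T ∈ S.powerset, if B ⊆ T ∧ T ⊆ C then (-1 : ℤ) ^ T.card else 0) =
      if B = C then (-1) ^ C.card else 0 := by
  rw [← Finset.sum_filter]
  by_cases hBC : B ⊆ C
  -- The interval between `B` and `C` is the set of all `B ∪ R` with `R ⊆ C \ B`, and the
  -- alternating sum over the subsets `R` vanishes unless `C \ B` is empty.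
  · have e : (S.powerset.filter fun T => B ⊆ T ∧ T ⊆ C) = (C \ B).powerset.image (B ∪ ·) := by
      ext T
      simp only [Finset.mem_filter, Finset.mem_powerset, Finset.mem_image]
      constructor
      · rintro ⟨-, h1, h2⟩
        exact ⟨T \ B, Finset.sdiff_subset_sdiff h2 subset_rfl, Finset.union_sdiff_of_subset h1⟩
      · rintro ⟨R, hR, rfl⟩
        have : B ∪ R ⊆ C := Finset.union_subset hBC (hR.trans Finset.sdiff_subset)
        exact ⟨this.trans hC, Finset.subset_union_left, this⟩
    have hdisj : ∀ R ∈ (C \ B).powerset, Disjoint B R := fun R hR =>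
      (Finset.disjoint_sdiff).mono_right (Finset.mem_powerset.1 hR)
    rw [e, Finset.sum_image]
    · have : ∀ R ∈ (C \ B).powerset, (-1 : ℤ) ^ (B ∪ R).card = (-1) ^ B.card * (-1) ^ R.card :=
        fun R hR => by rw [Finset.card_union_of_disjoint (hdisj R hR), pow_add]
      rw [Finset.sum_congr rfl this, ← Finset.mul_sum, Finset.sum_powerset_neg_one_pow_card]
      by_cases h : B = C
      · simp [h]
      · rw [if_neg h, if_neg, mul_zero]
        rw [Finset.sdiff_eq_empty_iff_subset]
        exact fun h' => h (hBC.antisymm h')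
    · intro R hR R' hR' h
      have h1 := hdisj R hR
      have h2 := hdisj R' hR'
      have := congrArg (· \ B) h
      simpa [Finset.union_sdiff_cancel_left h1, Finset.union_sdiff_cancel_left h2] using this
  · rw [Finset.filter_false_of_mem, Finset.sum_empty, if_neg]
    · rintro rfl; exact hBC subset_rfl
    · rintro T - ⟨h1, h2⟩
      exact hBC (h1.trans h2)

open Classical in
/-- The edges at `X` along which `g` decreases into the polyhedron of signs `s`. -/
noncomputable def descending (s : Fin N → ℝ) (g : (Fin k → ℝ) →ₗ[ℝ] ℝ) (X : A.Vertex) :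
    Finset (Fin N) :=
  Finset.univ.filter fun j =>
    ∃ h : j ∈ X.1, s j * A.l j (A.edge X ⟨j, h⟩) * g (A.edge X ⟨j, h⟩) < 0

open Classical in
/-- The signed count of the vertices whose cone of increase of `g` has the signs `S`, as an
alternating sum over faces; in particular it does not depend on `g`. -/
lemma sum_descending_eq (s : Fin N → ℝ) (hs : ∀ j, s j = 1 ∨ s j = -1)
    (g : (Fin k → ℝ) →ₗ[ℝ] ℝ) (hg : ∀ X j, g (A.edge X j) ≠ 0) (m : ℝ)
    (hm : ∀ y ∈ A.polyhedron s, m ≤ g y) (S : Finset (Fin N)) :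
    (∑ X : A.Vertex, if A.point X ∈ A.polyhedron s ∧ A.descending s g X = X.1 ∩ S
      then (-1 : ℤ) ^ (X.1 ∩ S).card else 0) =
    ∑ T ∈ S.powerset, if ∃ y ∈ A.polyhedron s, ∀ j ∈ T, A.f j y = 0 then (-1) ^ T.card else 0 := by
  have hs0 : ∀ j, s j ≠ 0 := fun j => by rcases hs j with h | h <;> rw [h] <;> norm_num
  have hiff : ∀ (X : A.Vertex) (T : Finset (Fin N)),
      (∀ j : {j // j ∈ X.1}, j.1 ∉ T → 0 < s j.1 * A.l j.1 (A.edge X j) * g (A.edge X j)) ↔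
        A.descending s g X ⊆ T := by
    intro X T
    constructor
    · intro h j hj
      obtain ⟨hjX, hneg⟩ := (Finset.mem_filter.1 hj).2
      by_contra hjT
      exact absurd (h ⟨j, hjX⟩ hjT) (not_lt.2 hneg.le)
    · intro h j hjT
      by_contra hneg
      have hlt : s j.1 * A.l j.1 (A.edge X j) * g (A.edge X j) < 0 :=
        lt_of_le_of_ne (not_lt.1 hneg)
          (mul_ne_zero (mul_ne_zero (hs0 _) (A.l_edge_self X j)) (hg X j))
      exact hjT (h (Finset.mem_filter.2 ⟨Finset.mem_univ _, j.2, hlt⟩))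
  -- For a nonempty face exactly one vertex passes the test on the right, the minimum of `g` there;
  -- for an empty one none does. Exchanging the sums then leaves, at each vertex, an alternating sum
  -- over an interval of sets `T`.
  have hface : ∀ T ∈ S.powerset,
      (if ∃ y ∈ A.polyhedron s, ∀ j ∈ T, A.f j y = 0 then (-1 : ℤ) ^ T.card else 0) =
      ∑ X : A.Vertex, if A.point X ∈ A.polyhedron s then
        (if A.descending s g X ⊆ T ∧ T ⊆ X.1 ∩ S then (-1 : ℤ) ^ T.card else 0) else 0 := by
    intro T hT
    rw [Finset.mem_powerset] at hT
    split_ifs with h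
    · obtain ⟨X, ⟨h1, h2, h3⟩, huniq⟩ := A.existsUnique_isOptimal s hs g hg m hm T h
      rw [Finset.sum_eq_single X]
      · rw [if_pos h1, if_pos ⟨(hiff X T).1 h3, Finset.subset_inter h2 hT⟩]
      · intro Y _ hYX
        by_cases hY : A.point Y ∈ A.polyhedron s
        · rw [if_pos hY, if_neg]
          rintro ⟨h4, h5⟩
          exact hYX (huniq Y ⟨hY, h5.trans Finset.inter_subset_left, (hiff Y T).2 h4⟩)
        · rw [if_neg hY]
      · simp
    · symm
      refine Finset.sum_eq_zero fun X _ => ?_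
      by_cases hX : A.point X ∈ A.polyhedron s
      · rw [if_pos hX, if_neg]
        rintro ⟨-, h5⟩
        exact h ⟨A.point X, hX, fun j hj =>
          A.f_point X (Finset.inter_subset_left (h5 hj))⟩
      · rw [if_neg hX]
  rw [Finset.sum_congr rfl hface, Finset.sum_comm]
  refine Finset.sum_congr rfl fun X _ => ?_
  by_cases hX : A.point X ∈ A.polyhedron s
  · simp only [hX, true_and, if_true]
    exact (sum_interval_neg_one_pow S _ _ Finset.inter_subset_right).symm
  · simp [hX]

/-- A point `y` of the polyhedron is the limit of the points `y + ε (x - y)`, which lie in the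
chamber when `x` does. -/
lemma polyhedron_bddBelow (s : Fin N → ℝ) (hne : (A.chamber s).Nonempty)
    (hb : BddBelow (A.f0 '' A.chamber s)) : ∃ m, ∀ y ∈ A.polyhedron s, m ≤ A.f0 y := by
  obtain ⟨x, hx⟩ := hne
  obtain ⟨m, hm⟩ := hb
  refine ⟨m, fun y hy => ?_⟩
  have h : ∀ ε ∈ Ioo (0 : ℝ) 1, m ≤ A.f0 y + ε * (A.f0 x - A.f0 y) := by
    intro ε hε
    have hmem : y + ε • (x - y) ∈ A.chamber s := by
      intro j
      rw [A.f_add, map_smul, A.f_sub, smul_eq_mul]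
      have h1 := mul_pos hε.1 (hx j)
      have h2 := mul_nonneg (sub_nonneg.2 hε.2.le) (hy j)
      nlinarith
    have := hm (mem_image_of_mem _ hmem)
    rwa [map_add, map_smul, map_sub, smul_eq_mul] at this
  have hlim : Tendsto (fun ε : ℝ => A.f0 y + ε * (A.f0 x - A.f0 y)) (𝓝[>] 0) (𝓝 (A.f0 y)) := by
    have : Continuous fun ε : ℝ => A.f0 y + ε * (A.f0 x - A.f0 y) := by fun_prop
    have h := this.tendsto 0
    simp only [zero_mul, add_zero] at h
    exact h.mono_left nhdsWithin_le_nhds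
  exact ge_of_tendsto hlim (by filter_upwards [Ioo_mem_nhdsGT one_pos] with ε hε using h ε hε)

open Classical in
/-- If some form is negative at `x` relatively to the polyhedron, the signed count of the
vertices whose cone contains `x` vanishes. -/
lemma sum_descending_eq_zero (s : Fin N → ℝ) (hs : ∀ j, s j = 1 ∨ s j = -1) (m : ℝ)
    (hm : ∀ y ∈ A.polyhedron s, m ≤ A.f0 y) (x : Fin k → ℝ) (hx : x ∈ A.compl)
    (S : Finset (Fin N)) (hS : ∀ j, j ∈ S ↔ s j * A.f j x < 0) (hSne : S.Nonempty) :
    (∑ X : A.Vertex, if A.point X ∈ A.polyhedron s ∧ A.descending s A.f0 X = X.1 ∩ S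
      then (-1 : ℤ) ^ (X.1 ∩ S).card else 0) = 0 := by
  obtain ⟨j₀, hj₀⟩ := hSne
  have hneg := (hS j₀).1 hj₀
  have hs0 : ∀ j, s j ≠ 0 := fun j => by rcases hs j with h | h <;> rw [h] <;> norm_num
  -- All conditions hold for small `η > 0`: the first since `s j₀ * f j₀ x < 0`, the second since it
  -- excludes finitely many values of `η`.
  obtain ⟨η, hη, hη1, hη2⟩ : ∃ η : ℝ, 0 < η ∧ s j₀ * A.f j₀ x + η * A.f0 x < η * m ∧
      ∀ (X : A.Vertex) (j : {j // j ∈ X.1}), s j₀ * A.l j₀ (A.edge X j) + η ≠ 0 := by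
    have h1 : ∀ᶠ η : ℝ in 𝓝[>] 0, s j₀ * A.f j₀ x + η * A.f0 x < η * m := by
      have c1 : Continuous fun η : ℝ => s j₀ * A.f j₀ x + η * A.f0 x - η * m := by fun_prop
      have : ∀ᶠ η : ℝ in 𝓝 0, s j₀ * A.f j₀ x + η * A.f0 x - η * m < 0 :=
        c1.continuousAt.eventually (gt_mem_nhds (by simpa using hneg))
      filter_upwards [nhdsWithin_le_nhds this] with η h
      linarith
    have h2 : ∀ᶠ η : ℝ in 𝓝[>] 0, ∀ (X : A.Vertex) (j : {j // j ∈ X.1}),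
        s j₀ * A.l j₀ (A.edge X j) + η ≠ 0 := by
      refine eventually_all.2 fun X => eventually_all.2 fun j => ?_
      by_cases h0 : s j₀ * A.l j₀ (A.edge X j) = 0
      · filter_upwards [self_mem_nhdsWithin] with η hη
        rw [h0, zero_add]
        exact (ne_of_gt hη)
      · have c1 : Continuous fun η : ℝ => s j₀ * A.l j₀ (A.edge X j) + η := by fun_prop
        exact nhdsWithin_le_nhds (c1.continuousAt.eventually_ne (by simpa using h0))
    obtain ⟨η, ⟨h3, h4⟩, h5⟩ := ((h1.and h2).and self_mem_nhdsWithin).exists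
    exact ⟨η, h5, h3, h4⟩
  -- On the polyhedron `s j₀ * f j₀ ≥ 0` and `f0 ≥ m` bound `g` from below, and by the choice of `η`
  -- the value `g x` is under this bound.
  set g : (Fin k → ℝ) →ₗ[ℝ] ℝ := s j₀ • A.l j₀ + η • A.f0 with hgdef
  have hgap : ∀ v, g v = s j₀ * A.l j₀ v + η * A.f0 v := fun v => by simp [hgdef]
  have hl : ∀ v, A.l j₀ v = A.f j₀ v - A.f j₀ 0 := fun v => by
    rw [← A.f_sub, sub_zero]
  have hgen : ∀ X j, g (A.edge X j) ≠ 0 := fun X j => by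
    rw [hgap, A.f0_edge, mul_one]
    exact hη2 X j
  have hgm : ∀ y ∈ A.polyhedron s, η * m - s j₀ * A.f j₀ 0 ≤ g y := by
    intro y hy
    rw [hgap, hl]
    have := hy j₀
    have := mul_le_mul_of_nonneg_left (hm y hy) hη.le
    linarith
  have hgx : g x < η * m - s j₀ * A.f j₀ 0 := by
    rw [hgap, hl]
    linarith
  -- The sum over faces does not involve the linear form, so `f0` may be replaced by `g`.
  rw [A.sum_descending_eq s hs A.f0 (fun X j => by rw [A.f0_edge]; exact one_ne_zero) m hm S,
    ← A.sum_descending_eq s hs g hgen _ hgm S]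
  refine Finset.sum_eq_zero fun X _ => if_neg ?_
  rintro ⟨hXP, hdesc⟩
  refine absurd (hgm _ hXP) (not_le.2 (lt_trans ?_ hgx))
  -- At a contributing vertex the slacks of `x` and the reduced costs of `g` have the same signs, so
  -- all terms of `g x - g X` are positive, against `g x < g X`.
  rw [← sub_pos, A.map_sub_point_eq_sum X]
  have := A.nonempty_vertex X
  refine Finset.sum_pos (fun j _ => ?_) Finset.univ_nonempty
  have hl0 := A.l_edge_self X j
  rw [A.reduced_cost_eq s hs]
  refine div_pos ?_ (sq_pos_of_ne_zero hl0)
  have hc0 : s j.1 * A.l j.1 (A.edge X j) * g (A.edge X j) ≠ 0 :=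
    mul_ne_zero (mul_ne_zero (hs0 _) hl0) (hgen X j)
  have hf0 : s j.1 * A.f j.1 x ≠ 0 := mul_ne_zero (hs0 _) (hx _)
  have hmem : j.1 ∈ A.descending s g X ↔ j.1 ∈ S := by
    rw [hdesc, Finset.mem_inter]
    exact and_iff_right j.2
  rw [hS, descending, Finset.mem_filter] at hmem
  simp only [Finset.mem_univ, j.2, exists_true_left, true_and] at hmem
  rcases lt_or_gt_of_ne hf0 with h | h
  · exact mul_pos_of_neg_of_neg h (hmem.2 h)
  · refine mul_pos h (lt_of_le_of_ne (not_lt.1 fun h2 => ?_) hc0.symm)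
    exact absurd (hmem.1 h2) (not_lt.2 h.le)

open Classical in
/-- The decomposition of the indicator function of a domain into those of the cones at
its vertices. -/
lemma sum_indicator_cone (s : Fin N → ℝ) (hs : ∀ j, s j = 1 ∨ s j = -1)
    (hne : (A.chamber s).Nonempty) (hb : BddBelow (A.f0 '' A.chamber s))
    (x : Fin k → ℝ) (hx : x ∈ A.compl) :
    (∑ X ∈ A.boundaryVertices (A.chamber s), if x ∈ A.cone X
      then (-1 : ℤ) ^ (separating A (A.chamber s) (A.domainAt X)).card else 0) =
    if x ∈ A.chamber s then 1 else 0 := by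
  have hs0 : ∀ j, s j ≠ 0 := fun j => by rcases hs j with h | h <;> rw [h] <;> norm_num
  obtain ⟨m, hm⟩ := A.polyhedron_bddBelow s hne hb
  set S : Finset (Fin N) := Finset.univ.filter fun j => s j * A.f j x < 0 with hSdef
  have hS : ∀ j, j ∈ S ↔ s j * A.f j x < 0 := fun j => by simp [hSdef]
  have hbd : ∀ X : A.Vertex, X ∈ A.boundaryVertices (A.chamber s) ↔
      A.point X ∈ A.polyhedron s := by
    intro X
    rw [boundaryVertices, Finset.mem_filter, A.mem_frontier_chamber s hs]
    simp only [Finset.mem_univ, true_and]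
    constructor
    · intro h j
      by_cases hj : j ∈ X.1
      · rw [A.f_point X hj, mul_zero]
      · exact (h j hj).le
    · intro h j hj
      exact lt_of_le_of_ne (h j) (mul_ne_zero (hs0 j) (A.f_point_ne X hj)).symm
  -- A separating hyperplane passes through `X`; for `j ∈ X`, as `f0 = 1` on the edges, a negative
  -- reduced cost means that `s j` differs from the sign on `Δ_X`.
  have hsep : ∀ X ∈ A.boundaryVertices (A.chamber s),
      separating A (A.chamber s) (A.domainAt X) = A.descending s A.f0 X := by
    intro X hX
    ext j
    rw [A.domainAt_eq, A.mem_separating_chamber s _ hs (A.side_eq_or X) hne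
      (by rw [← A.domainAt_eq]; exact A.domainAt_nonempty X), descending, Finset.mem_filter]
    simp only [Finset.mem_univ, true_and, A.f0_edge, mul_one]
    by_cases hj : j ∈ X.1
    · have h1 : 0 < A.side X j * A.l j (A.edge X ⟨j, hj⟩) := by
        rw [A.side_mul_pos_of_mem X hj]
        exact mul_self_pos.2 (A.l_edge_self X ⟨j, hj⟩)
      simp only [hj, exists_true_left]
      rcases hs j with e | e <;> rcases A.side_eq_or X j with e' | e' <;> rw [e'] at h1 <;>
        rw [e, e']
      · simp; linarith
      · norm_num; linarith
      · norm_num; linarith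
      · simp; linarith
    · simp only [hj, IsEmpty.exists_iff, iff_false, not_not]
      refine A.side_eq_of_notMem s hs X hj ?_
      exact lt_of_le_of_ne ((hbd X).1 hX j) (mul_ne_zero (hs0 j) (A.f_point_ne X hj)).symm
  -- For `j ∈ X`, being on the side of `Δ_X` means being on the wrong side for `s` exactly when `s
  -- j` differs from the sign on `Δ_X`.
  have hcone : ∀ X : A.Vertex, x ∈ A.cone X ↔ A.descending s A.f0 X = X.1 ∩ S := by
    intro X
    rw [A.mem_cone_iff, Finset.ext_iff]
    refine forall_congr' fun j => ?_
    rw [descending, Finset.mem_filter, Finset.mem_inter, hS]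
    simp only [Finset.mem_univ, true_and, A.f0_edge, mul_one]
    by_cases hj : j ∈ X.1
    · have h1 : 0 < A.side X j * A.l j (A.edge X ⟨j, hj⟩) := by
        rw [A.side_mul_pos_of_mem X hj]
        exact mul_self_pos.2 (A.l_edge_self X ⟨j, hj⟩)
      have hx0 := hx j
      simp only [hj, exists_true_left, true_and, true_imp_iff]
      rcases lt_or_gt_of_ne hx0 with h | h <;>
      rcases hs j with e | e <;> rcases A.side_eq_or X j with e' | e' <;> rw [e'] at h1 <;>
        rw [e, e'] <;> constructor <;> intro h3 <;>
        first
        | (constructor <;> intro h4 <;> linarith)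
        | (by_contra h4
           first
           | linarith [h3.1 (by linarith)]
           | linarith [h3.2 (by linarith)])
    · simp [hj]
  have hsum : (∑ X ∈ A.boundaryVertices (A.chamber s), if x ∈ A.cone X
      then (-1 : ℤ) ^ (separating A (A.chamber s) (A.domainAt X)).card else 0) =
      ∑ X : A.Vertex, if A.point X ∈ A.polyhedron s ∧ A.descending s A.f0 X = X.1 ∩ S
      then (-1 : ℤ) ^ (X.1 ∩ S).card else 0 := by
    have e : A.boundaryVertices (A.chamber s) =
        Finset.univ.filter fun X => A.point X ∈ A.polyhedron s := by
      ext X; simp [hbd]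
    rw [Finset.sum_congr e (g := fun X => if A.descending s A.f0 X = X.1 ∩ S
      then (-1 : ℤ) ^ (X.1 ∩ S).card else 0), Finset.sum_filter]
    · refine Finset.sum_congr rfl fun X _ => ?_
      by_cases h : A.point X ∈ A.polyhedron s <;> simp [h]
    · intro X hX
      rw [← e] at hX
      rw [hsep X hX]
      by_cases h : A.descending s A.f0 X = X.1 ∩ S
      · rw [if_pos ((hcone X).2 h), if_pos h, h]
      · rw [if_neg (fun h' => h ((hcone X).1 h')), if_neg h]
  rw [hsum]
  by_cases hSe : S.Nonempty
  · rw [A.sum_descending_eq_zero s hs m hm x hx S hS hSe, if_neg]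
    intro h
    obtain ⟨j, hj⟩ := hSe
    exact absurd (h j) (not_lt.2 ((hS j).1 hj).le)
  · rw [Finset.not_nonempty_iff_eq_empty] at hSe
    have hxs : x ∈ A.chamber s := by
      intro j
      refine lt_of_le_of_ne (not_lt.1 fun h => ?_) (mul_ne_zero (hs0 j) (hx j)).symm
      have := (hS j).2 h
      rw [hSe] at this
      simp at this
    -- Only `T = ∅` is left, whose face is the whole polyhedron; it contains `x`.
    rw [A.sum_descending_eq s hs A.f0 (fun X j => by rw [A.f0_edge]; exact one_ne_zero) m hm S,
      hSe, if_pos hxs]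
    simp only [Finset.powerset_empty, Finset.sum_singleton, Finset.card_empty, pow_zero]
    exact if_pos ⟨x, fun j => (hxs j).le, by simp⟩

/-! ### Identification of the analytic continuation -/

/-- The determination of `∏ j, |f j| ^ α j` given by the principal powers of the forms
`± f j` that are positive on `Δ_X`. -/
noncomputable def principalBranch (X : A.Vertex) (z : Fin k → ℂ) : ℂ :=
  ∏ j, ((A.side X j : ℂ) * A.fC j z) ^ (A.α j : ℂ)

lemma side_ne_zero (X : A.Vertex) (j : Fin N) : A.side X j ≠ 0 := by
  rcases A.side_eq_or X j with h | h <;> rw [h] <;> norm_num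

/-- On the rotated cone the form is `f j X + t * l j (x - X)`: it is not real unless `l j (x - X) =
0`, and then it keeps its value at `X`, which has the sign of `Δ_X`. -/
lemma side_mul_fC_mem_slitPlane (X : A.Vertex) {x : Fin k → ℝ} (hx : x ∈ A.cone X) {t : ℂ}
    (ht : t.im ≠ 0) (j : Fin N) :
    (A.side X j : ℂ) * A.fC j (A.rotate X t x) ∈ Complex.slitPlane := by
  rw [A.fC_rotate]
  by_cases hl : A.l j (x - A.point X) = 0
  · have hj : j ∉ X.1 := by
      intro hj
      rw [A.l_sub_point X hj] at hl
      have := (A.mem_cone_iff X x).1 hx j hj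
      rw [hl, mul_zero] at this
      exact lt_irrefl _ this
    rw [hl, Complex.ofReal_zero, mul_zero, add_zero, ← Complex.ofReal_mul,
      Complex.ofReal_mem_slitPlane]
    exact A.side_mul_point_pos X hj
  · refine Complex.mem_slitPlane_iff.2 (Or.inr ?_)
    simp [A.side_ne_zero, ht, hl, -map_sub]

lemma side_mul_fC_incl_mem_slitPlane (X : A.Vertex) {x : Fin k → ℝ} (hx : x ∈ A.domainAt X)
    (j : Fin N) : (A.side X j : ℂ) * A.fC j (incl x) ∈ Complex.slitPlane := by
  rw [A.fC_incl, ← Complex.ofReal_mul, Complex.ofReal_mem_slitPlane]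
  rw [A.domainAt_eq] at hx
  exact hx j

lemma principalBranch_incl (X : A.Vertex) {x : Fin k → ℝ} (hx : x ∈ A.domainAt X) :
    A.principalBranch X (incl x) = ((∏ j, |A.f j x| ^ A.α j : ℝ) : ℂ) := by
  rw [A.domainAt_eq] at hx
  rw [principalBranch, Complex.ofReal_prod]
  refine Finset.prod_congr rfl fun j _ => ?_
  have h : A.side X j * A.f j x = |A.f j x| := by
    have h := hx j
    have : |A.side X j * A.f j x| = |A.f j x| := by
      rw [abs_mul]
      rcases A.side_eq_or X j with e | e <;> rw [e] <;> simp
    rw [← this, abs_of_pos h]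
  rw [A.fC_incl, ← Complex.ofReal_mul, h, Complex.ofReal_cpow (abs_nonneg _)]

lemma rotate_ofReal (X : A.Vertex) (r : ℝ) (x : Fin k → ℝ) :
    A.rotate X r x = incl (A.point X + r • (x - A.point X)) := by
  ext i
  simp [rotate, incl]

/-- A positive modulus can be moved from the factor to the point of the cone; the extension from
`‖ρ‖ = 1` to arbitrary factors and the dilation invariance of the integral both come from this. -/
lemma rotate_smul (X : A.Vertex) (r : ℝ) (t : ℂ) (x : Fin k → ℝ) :
    A.rotate X (r * t) x = A.rotate X t (A.point X + r • (x - A.point X)) := by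
  ext i
  simp [rotate, incl]
  ring

lemma analyticAt_rotate (X : A.Vertex) (x : Fin k → ℝ) (t : ℂ) :
    AnalyticAt ℂ (fun t => A.rotate X t x) t :=
  analyticAt_const.add (analyticAt_id.smul analyticAt_const)

lemma analyticAt_principalBranch (X : A.Vertex) {z : Fin k → ℂ}
    (hz : ∀ j, (A.side X j : ℂ) * A.fC j z ∈ Complex.slitPlane) :
    AnalyticAt ℂ (A.principalBranch X) z :=
  Finset.analyticAt_fun_prod _ fun j _ =>
    (analyticAt_const.mul (A.analyticAt_fC j z)).cpow analyticAt_const (hz j)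

/-- On the rotated cones the analytic continuation is the product of principal powers. -/
lemma branch_rotate (X : A.Vertex) (σ : ℝ) {ρ : ℂ} (hρ : 0 < σ * ρ.im)
    {x : Fin k → ℝ} (hx : x ∈ A.cone X) :
    A.branch X σ (A.rotate X ρ x) = A.principalBranch X (A.rotate X ρ x) := by
  obtain ⟨D, -, -, -, hcone, hincl, hana, hreal⟩ := A.branch_spec X σ
  obtain ⟨ε, hε, -, hsm⟩ := A.exists_small X (x - A.point X) 1 one_pos
  -- A form outside `X` is affine in `r` and has the sign of its value at `X` both at `r = 0` and at
  -- `r = ε`, hence in between.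
  have hdom : ∀ r : ℝ, 0 < r → r < ε →
      A.point X + r • (x - A.point X) ∈ A.domainAt X := by
    intro r hr hrε
    rw [A.domainAt_eq]
    intro j
    by_cases hj : j ∈ X.1
    · exact (A.mem_cone_iff X _).1 ((A.smul_mem_cone X hr).2 hx) j hj
    · rw [A.side_mul_pos_of_notMem X hj]
      have h1 := hsm j hj
      have h2 := mul_self_pos.2 (A.f_point_ne X hj)
      rw [A.f_add, map_smul, smul_eq_mul] at h1 ⊢
      rcases le_total 0 (A.f j (A.point X) * A.l j (x - A.point X)) with h | h
      · nlinarith [mul_nonneg hr.le h]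
      · nlinarith [mul_nonneg (sub_nonneg.2 hrε.le) (neg_nonneg.2 h)]
  -- The identity theorem is applied in one variable, along `w ↦ X + w (x - X)`. The set `T` joins
  -- the open half-plane containing `ρ` to a real segment mapped into `Δ_X`, where both functions
  -- are known; it is convex, hence connected.
  set T : Set ℂ := {w | 0 < σ * w.im ∨ (w.im = 0 ∧ 0 < w.re ∧ w.re < ε)} with hT
  have hTconv : Convex ℝ T := by
    rintro w hw w' hw' a b ha hb hab
    have him : (a • w + b • w').im = a * w.im + b * w'.im := by simp
    have hre : (a • w + b • w').re = a * w.re + b * w'.re := by simp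
    rw [hT, Set.mem_ofPred_eq, him, hre]
    rcases ha.eq_or_lt with ha0 | ha0
    · have : b = 1 := by linarith
      subst this
      rw [← ha0]
      simp only [zero_mul, one_mul, zero_add]
      exact hw'
    rcases hb.eq_or_lt with hb0 | hb0
    · have : a = 1 := by linarith
      subst this
      rw [← hb0]
      simp only [zero_mul, one_mul, add_zero]
      exact hw
    rcases hw with hw | ⟨h1, h2, h3⟩ <;> rcases hw' with hw' | ⟨h1', h2', h3'⟩
    · left; nlinarith [mul_pos ha0 hw, mul_pos hb0 hw']
    · left; rw [h1']; nlinarith [mul_pos ha0 hw]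
    · left; rw [h1]; nlinarith [mul_pos hb0 hw']
    · right
      refine ⟨by rw [h1, h1']; ring, by positivity, ?_⟩
      have : ε = a * ε + b * ε := by rw [← add_mul, hab, one_mul]
      rw [this]
      exact add_lt_add (mul_lt_mul_of_pos_left h3 ha0) (mul_lt_mul_of_pos_left h3' hb0)
  have hreal_im : ∀ w ∈ T, w.im = 0 → w = (w.re : ℂ) ∧ 0 < w.re ∧ w.re < ε := by
    rintro w (hw | ⟨h1, h2, h3⟩) h0
    · rw [h0, mul_zero] at hw
      exact absurd hw (lt_irrefl _)
    · exact ⟨Complex.ext rfl (by simpa using h0), h2, h3⟩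
  have hTD : ∀ w ∈ T, A.rotate X w x ∈ D := by
    intro w hw
    by_cases h0 : w.im = 0
    · obtain ⟨h1, h2, h3⟩ := hreal_im w hw h0
      rw [h1, A.rotate_ofReal]
      exact hincl (mem_image_of_mem _ (hdom _ h2 h3))
    · have hw' : 0 < σ * w.im := by
        rcases hw with hw | hw
        · exact hw
        · exact absurd hw.1 h0
      have hw0 : w ≠ 0 := fun h => h0 (by rw [h]; rfl)
      have hn : 0 < ‖w‖ := norm_pos_iff.2 hw0
      -- The domain `D` is only known to contain the cones with `‖ρ‖ = 1`, so the modulus of `w` is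
      -- absorbed into `x`.
      have hdec : w = (‖w‖ : ℂ) * (((‖w‖⁻¹ : ℝ) : ℂ) * w) := by
        have : (‖w‖ : ℂ) ≠ 0 := by exact_mod_cast hn.ne'
        push_cast
        field_simp
      rw [hdec, A.rotate_smul]
      refine hcone _ ?_ ?_ (mem_image_of_mem _ ((A.smul_mem_cone X hn).2 hx))
      · rw [norm_mul, Complex.norm_real, norm_inv, norm_norm, inv_mul_cancel₀ hn.ne']
      · rw [Complex.im_ofReal_mul, mul_left_comm]
        positivity
  have hTslit : ∀ w ∈ T, ∀ j, (A.side X j : ℂ) * A.fC j (A.rotate X w x) ∈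
      Complex.slitPlane := by
    intro w hw j
    by_cases h0 : w.im = 0
    · obtain ⟨h1, h2, h3⟩ := hreal_im w hw h0
      rw [h1, A.rotate_ofReal]
      exact A.side_mul_fC_incl_mem_slitPlane X (hdom _ h2 h3) j
    · exact A.side_mul_fC_mem_slitPlane X hx h0 j
  have hz₀ : ((ε / 2 : ℝ) : ℂ) ∈ T := by
    right
    refine ⟨Complex.ofReal_im _, ?_, ?_⟩ <;> rw [Complex.ofReal_re] <;> linarith
  refine AnalyticOnNhd.eqOn_of_preconnected_of_frequently_eq
    (f := fun w => A.branch X σ (A.rotate X w x))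
    (g := fun w => A.principalBranch X (A.rotate X w x))
    (fun w hw => (hana _ (hTD w hw)).comp_of_eq (A.analyticAt_rotate X x w) rfl)
    (fun w hw => (A.analyticAt_principalBranch X (hTslit w hw)).comp_of_eq (A.analyticAt_rotate X x w) rfl)
    hTconv.isPreconnected hz₀ ?_ (Or.inl hρ : ρ ∈ T)
  -- Both functions are the real product at the real points near `ε / 2`, which accumulate there.
  have hev : ∀ᶠ r : ℝ in 𝓝[≠] (ε / 2), A.branch X σ (A.rotate X (r : ℂ) x) =
      A.principalBranch X (A.rotate X (r : ℂ) x) := by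
    filter_upwards [nhdsWithin_le_nhds (Ioo_mem_nhds (half_pos hε) (half_lt_self hε))] with r hr
    rw [A.rotate_ofReal, hreal _ (hdom r hr.1 hr.2), A.principalBranch_incl X (hdom r hr.1 hr.2)]
  have htend : Tendsto (fun r : ℝ => (r : ℂ)) (𝓝[≠] (ε / 2)) (𝓝[≠] ((ε / 2 : ℝ) : ℂ)) :=
    Complex.continuous_ofReal.continuousAt.tendsto.inf
      (tendsto_principal_principal.2 fun r hr h => hr (Complex.ofReal_injective h))
  exact htend.frequently hev.frequently

end Arrangement

/-! ### Integrable bounds -/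

lemma integrable_abs_rpow_mul_exp {s η : ℝ} (hs : -1 < s) (hη : 0 < η) :
    Integrable fun y : ℝ => |y| ^ s * Real.exp (-η * |y|) := by
  have h : IntegrableOn (fun y : ℝ => |y| ^ s * Real.exp (-η * |y|)) (Ioi 0) := by
    refine (integrableOn_rpow_mul_exp_neg_mul_rpow hs one_pos hη).congr_fun (fun y hy => ?_)
      measurableSet_Ioi
    simp only [Real.rpow_one, abs_of_pos (mem_Ioi.1 hy)]
  have h' : IntegrableOn (fun y : ℝ => |y| ^ s * Real.exp (-η * |y|)) (Iic 0) := by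
    have h0 : IntegrableOn (fun y : ℝ => |y| ^ s * Real.exp (-η * |y|)) (Ici (-0)) := by
      rw [neg_zero]
      exact (integrableOn_Ici_iff_integrableOn_Ioi enorm_ne_top).2 h
    simpa using h0.comp_neg_Iic
  rw [← integrableOn_univ, ← Iic_union_Ioi (a := (0 : ℝ))]
  exact h'.union h

/-- The exponent `α - 1` is split into `α - min α 1 ≥ 0`, where the upper bound `p` of `u` serves,
and `min α 1 - 1 ≤ 0`, where the lower bound `v` serves. The latter exponent exceeds `-1`, so the
singularity remains integrable. -/
lemma rpow_mul_inv_le {α u v p : ℝ} (hα : 0 < α) (hv : 0 < v) (hvu : v ≤ u) (hup : u ≤ p)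
    (hp : 1 ≤ p) : u ^ α * u⁻¹ ≤ p ^ α * v ^ (min α 1 - 1) := by
  have hu : 0 < u := hv.trans_le hvu
  have e : u ^ α * u⁻¹ = u ^ (α - min α 1) * u ^ (min α 1 - 1) := by
    rw [← Real.rpow_neg_one u, ← Real.rpow_add hu, ← Real.rpow_add hu]
    ring_nf
  rw [e]
  refine mul_le_mul ?_ ?_ (by positivity) (by positivity)
  · refine (Real.rpow_le_rpow hu.le hup (sub_nonneg.2 (min_le_left _ _))).trans ?_
    refine Real.rpow_le_rpow_of_exponent_le hp ?_
    have : 0 < min α 1 := lt_min hα one_pos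
    linarith
  · exact Real.rpow_le_rpow_of_nonpos hv hvu (sub_nonpos.2 (min_le_right _ _))

lemma exists_rpow_le_exp (m K : ℝ) (hK : 1 ≤ K) {β : ℝ} (hβ : 0 < β) :
    ∃ C : ℝ, 0 ≤ C ∧ ∀ h : ℝ, 0 ≤ h → (K * (1 + h)) ^ m ≤ C * Real.exp (β * h) := by
  obtain ⟨n, hn⟩ := exists_nat_ge m
  refine ⟨(K / β) ^ n * n.factorial * Real.exp β, by positivity, fun h hh => ?_⟩
  have h1 : 1 ≤ K * (1 + h) := by nlinarith
  have h2 : (K * (1 + h)) ^ m ≤ (K * (1 + h)) ^ n := by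
    rw [← Real.rpow_natCast]
    exact Real.rpow_le_rpow_of_exponent_le h1 hn
  have h3 := Real.pow_div_factorial_le_exp (β * (1 + h)) (by positivity) n
  rw [div_le_iff₀ (by positivity)] at h3
  have e : (K * (1 + h)) ^ n = (K / β) ^ n * (β * (1 + h)) ^ n := by
    rw [← mul_pow]
    congr 1
    field_simp
  refine h2.trans ?_
  rw [e]
  calc (K / β) ^ n * (β * (1 + h)) ^ n
      ≤ (K / β) ^ n * (Real.exp (β * (1 + h)) * n.factorial) := by gcongr
    _ = _ := by rw [mul_add, mul_one, Real.exp_add]; ring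

namespace Arrangement

variable {k N : ℕ} (A : Arrangement k N)

/-- The linear map with components the forms directing the hyperplanes of a vertex. -/
noncomputable def formsMap (X : A.Vertex) : (Fin k → ℝ) →ₗ[ℝ] (Fin k → ℝ) :=
  LinearMap.pi fun r => A.l (X.1.orderEmbOfFin X.2 r)

lemma det_formsMap_ne_zero (X : A.Vertex) : LinearMap.det (A.formsMap X) ≠ 0 := by
  rw [← isUnit_iff_ne_zero]
  refine LinearMap.isUnit_det _ ((LinearMap.isUnit_iff_ker_eq_bot _).2 ?_)
  refine LinearMap.ker_eq_bot'.2 fun v hv => A.eq_zero_of_l X v fun j hj => ?_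
  have : j ∈ Set.range (X.1.orderEmbOfFin X.2) := by
    rw [Finset.range_orderEmbOfFin]
    exact hj
  obtain ⟨r, rfl⟩ := this
  exact congrFun hv r

lemma prod_vertex (X : A.Vertex) (F : Fin N → ℝ) :
    ∏ j ∈ X.1, F j = ∏ r : Fin k, F (X.1.orderEmbOfFin X.2 r) := by
  conv_lhs => rw [← Finset.map_orderEmbOfFin_univ X.1 X.2]
  rw [Finset.prod_map]
  rfl

/-- The forms of a vertex are affine coordinates on `ℝ^k`, in which the integral splits into
one-dimensional ones; the linear change of variables only rescales Lebesgue measure. -/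
lemma integrable_prod_forms (X : A.Vertex) (φ : Fin N → ℝ → ℝ) (hφ : ∀ j, Integrable (φ j)) :
    Integrable fun x => ∏ j ∈ X.1, φ j (A.f j x) := by
  set G : (Fin k → ℝ) → ℝ := fun y => ∏ r : Fin k,
    φ (X.1.orderEmbOfFin X.2 r) (y r + A.f (X.1.orderEmbOfFin X.2 r) 0) with hG
  have hGi : Integrable G := by
    have := Integrable.fintype_prod (μ := fun _ : Fin k => (volume : Measure ℝ))
      (f := fun r y => φ (X.1.orderEmbOfFin X.2 r) (y + A.f (X.1.orderEmbOfFin X.2 r) 0))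
      fun r => (hφ _).comp_add_right _
    exact this
  have e : (fun x => ∏ j ∈ X.1, φ j (A.f j x)) = G ∘ A.formsMap X := by
    ext x
    rw [A.prod_vertex X fun j => φ j (A.f j x)]
    refine Finset.prod_congr rfl fun r _ => ?_
    have := A.f_add (X.1.orderEmbOfFin X.2 r) 0 x
    rw [zero_add, add_comm] at this
    rw [this]
    rfl
  rw [e]
  have hmeas : Measurable (A.formsMap X) :=
    (LinearMap.continuous_of_finiteDimensional _).measurable
  refine Integrable.comp_measurable ?_ hmeas
  rw [Measure.map_linearMap_addHaar_eq_smul_addHaar _ (A.det_formsMap_ne_zero X)]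
  exact hGi.smul_measure ENNReal.ofReal_ne_top

/-- The integrand of `I_X^ρ`, for an arbitrary complex factor `t` in place of `ρ`, with the
determination by principal powers. -/
noncomputable def scaledIntegrand (X : A.Vertex) (lam : ℂ) (X' : A.Vertex) (t : ℂ)
    (x : Fin k → ℝ) : ℂ :=
  Complex.exp (-lam * complexify A.f0 (A.rotate X t x)) *
    A.principalBranch X (A.rotate X t x) *
    A.omega X' (A.rotate X t x) fun s => t • stdVec s

lemma wedge_smul (X : A.Vertex) (t : ℂ) :
    (A.wedge X fun s => t • stdVec s) = t ^ k * A.wedge X stdVec := by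
  have : (Matrix.of fun r s => complexify (A.l (X.1.orderEmbOfFin X.2 r)) (t • stdVec s)) =
      t • (Matrix.of fun r s : Fin k =>
        complexify (A.l (X.1.orderEmbOfFin X.2 r)) (stdVec s)) := by
    ext r s
    simp [complexify_smul]
  rw [wedge, this, Matrix.det_smul, Fintype.card_fin, wedge]

lemma omega_smul (X : A.Vertex) (z : Fin k → ℂ) (t : ℂ) :
    (A.omega X z fun s => t • stdVec s) = t ^ k * A.omega X z stdVec := by
  rw [omega, omega, wedge_smul]
  ring

lemma norm_principalBranch (X : A.Vertex) (z : Fin k → ℂ) :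
    ‖A.principalBranch X z‖ = ∏ j, ‖A.fC j z‖ ^ A.α j := by
  rw [principalBranch, norm_prod]
  refine Finset.prod_congr rfl fun j _ => ?_
  rw [Complex.norm_cpow_real, norm_mul, Complex.norm_real]
  rcases A.side_eq_or X j with h | h <;> rw [h] <;> simp

lemma complexify_f0_rotate (X : A.Vertex) (t : ℂ) (x : Fin k → ℝ) :
    complexify A.f0 (A.rotate X t x) = A.f0 (A.point X) + t * A.f0 (x - A.point X) := by
  rw [rotate, complexify_add, complexify_smul, complexify_incl, complexify_incl]

lemma norm_exp_rotate (X : A.Vertex) (lam : ℝ) (t : ℂ) (x : Fin k → ℝ) :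
    ‖Complex.exp (-lam * complexify A.f0 (A.rotate X t x))‖ =
      Real.exp (-lam * A.f0 (A.point X)) * Real.exp (-lam * t.re * A.f0 (x - A.point X)) := by
  rw [Complex.norm_exp, A.complexify_f0_rotate, ← Real.exp_add]
  congr 1
  rw [← Complex.ofReal_neg, Complex.re_ofReal_mul]
  simp [-map_sub]
  ring

lemma norm_scaledIntegrand (X X' : A.Vertex) (lam : ℝ) (t : ℂ) (x : Fin k → ℝ) :
    ‖A.scaledIntegrand X lam X' t x‖ =
      Real.exp (-lam * A.f0 (A.point X)) * Real.exp (-lam * t.re * A.f0 (x - A.point X)) *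
      ((∏ j, ‖A.fC j (A.rotate X t x)‖ ^ A.α j) * ∏ j ∈ X'.1, ‖A.fC j (A.rotate X t x)‖⁻¹) *
      (‖t‖ ^ k * ‖(A.orientSign X' : ℂ) * A.wedge X' stdVec‖) := by
  rw [scaledIntegrand, omega_smul, omega, norm_mul, norm_mul, norm_mul, norm_mul, norm_pow,
    A.norm_exp_rotate, A.norm_principalBranch, norm_inv, norm_prod, Finset.prod_inv_distrib]
  ring

lemma f0_sub_pos (X : A.Vertex) {x : Fin k → ℝ} (hx : x ∈ A.cone X) :
    0 < A.f0 (x - A.point X) := by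
  obtain ⟨a, ha, rfl⟩ := hx
  rw [add_sub_cancel_left, map_sum]
  have := A.nonempty_vertex X
  refine Finset.sum_pos (fun j _ => ?_) Finset.univ_nonempty
  rw [map_smul, A.f0_edge, smul_eq_mul, mul_one]
  exact ha j

/-- On the cone `f0 (x - X)` is the sum of the coordinates `a j > 0`, so it dominates every linear
form. -/
lemma exists_abs_l_le (X : A.Vertex) : ∃ C : ℝ, 0 ≤ C ∧ ∀ x ∈ A.cone X, ∀ j,
    |A.l j (x - A.point X)| ≤ C * A.f0 (x - A.point X) := by
  refine ⟨∑ j, ∑ i : {j // j ∈ X.1}, |A.l j (A.edge X i)|,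
    Finset.sum_nonneg fun _ _ => Finset.sum_nonneg fun _ _ => abs_nonneg _, ?_⟩
  rintro x ⟨a, ha, rfl⟩ j
  rw [add_sub_cancel_left, map_sum, map_sum, Finset.mul_sum]
  refine (Finset.abs_sum_le_sum_abs _ _).trans (Finset.sum_le_sum fun i _ => ?_)
  rw [map_smul, map_smul, A.f0_edge, smul_eq_mul, smul_eq_mul, mul_one, abs_mul,
    abs_of_pos (ha i), mul_comm]
  refine mul_le_mul_of_nonneg_right ?_ (ha i).le
  refine (Finset.single_le_sum (f := fun i => |A.l j (A.edge X i)|)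
    (fun _ _ => abs_nonneg _) (Finset.mem_univ i)).trans ?_
  exact Finset.single_le_sum (f := fun j => ∑ i : {j // j ∈ X.1}, |A.l j (A.edge X i)|)
    (fun _ _ => Finset.sum_nonneg fun _ _ => abs_nonneg _) (Finset.mem_univ j)

/-- An integrable bound of the integrands, uniform in the factor `t` as long as the forms
`f j` do not come closer to `0` than on the real cone. -/
lemma exists_bound (X X' : A.Vertex) {lam c M δ : ℝ} (hlam : 0 < lam) (hc : 0 < c) (hM : 0 < M)
    (hδ : 0 < δ) : ∃ B : (Fin k → ℝ) → ℝ, Integrable B ∧ ∀ x ∈ A.cone X, x ∈ A.compl →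
      ∀ t : ℂ, ‖t‖ ≤ M → δ ≤ t.re → (∀ j, c * |A.f j x| ≤ ‖A.fC j (A.rotate X t x)‖) →
        ‖A.scaledIntegrand X lam X' t x‖ ≤ B x := by
  obtain ⟨C, hC, hCl⟩ := A.exists_abs_l_le X
  -- With `h = f0 (x - X)`, the bound `K * (1 + h)` holds for the forms both on the rotated cone
  -- (the part `M * C`) and on the real one (the part `C`).
  set K : ℝ := 1 + ∑ j, |A.f j (A.point X)| + (M + 1) * C with hK
  have hS : 0 ≤ ∑ j, |A.f j (A.point X)| := Finset.sum_nonneg fun _ _ => abs_nonneg _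
  have hK1 : 1 ≤ K := by
    have : 0 ≤ (M + 1) * C := by positivity
    linarith
  have hKp : 0 < K := by linarith
  have hkp : (0 : ℝ) < k := by exact_mod_cast A.k_pos
  -- The decay `exp (-λ δ h)` is cut into two halves `exp (-β h)`: one absorbs the growth of the
  -- powers, the other is spread over the forms of `X'`, with rate `η` since the sum of their
  -- absolute values is at most `k * K * (1 + h)`.
  set β : ℝ := lam * δ / 2 with hβ
  have hβp : 0 < β := by positivity
  set η : ℝ := β / (k * K) with hη
  have hηp : 0 < η := by positivity
  obtain ⟨C₁, hC₁, hC₁l⟩ := exists_rpow_le_exp (∑ j, A.α j) K hK1 hβp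
  set W : ℝ := ‖(A.orientSign X' : ℂ) * A.wedge X' stdVec‖ with hW
  set C₂ : ℝ := Real.exp (-lam * A.f0 (A.point X)) * (C₁ * Real.exp β) * (M ^ k * W) with hC₂
  refine ⟨fun x => C₂ * ∏ j ∈ X'.1,
    ((c * |A.f j x|) ^ (min (A.α j) 1 - 1) * Real.exp (-η * |A.f j x|)), ?_, ?_⟩
  · refine Integrable.const_mul (A.integrable_prod_forms X' (fun j y =>
      (c * |y|) ^ (min (A.α j) 1 - 1) * Real.exp (-η * |y|)) fun j => ?_) _
    have hs : -1 < min (A.α j) 1 - 1 := by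
      have : 0 < min (A.α j) 1 := lt_min (A.α_pos j) one_pos
      linarith
    refine ((integrable_abs_rpow_mul_exp hs hηp).const_mul
      (c ^ (min (A.α j) 1 - 1))).congr (Eventually.of_forall fun y => ?_)
    beta_reduce
    rw [Real.mul_rpow hc.le (abs_nonneg _), mul_assoc]
  · intro x hx hxc t htM htδ hcl
    set h := A.f0 (x - A.point X) with hh
    have hhp : 0 < h := A.f0_sub_pos X hx
    have hu : ∀ j, ‖A.fC j (A.rotate X t x)‖ ≤ K * (1 + h) := by
      intro j
      rw [A.fC_rotate]
      refine (norm_add_le _ _).trans ?_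
      rw [norm_mul, Complex.norm_real, Complex.norm_real, Real.norm_eq_abs, Real.norm_eq_abs]
      have h1 := Finset.single_le_sum (f := fun j => |A.f j (A.point X)|)
        (fun _ _ => abs_nonneg _) (Finset.mem_univ j)
      have h2 : ‖t‖ * |A.l j (x - A.point X)| ≤ M * (C * h) :=
        mul_le_mul htM (hCl x hx j) (abs_nonneg _) hM.le
      have h3 : 0 ≤ C * h := by positivity
      have h4 := mul_nonneg hS hhp.le
      have h5 : 0 ≤ M * C := by positivity
      rw [hK]
      nlinarith
    have hfx : ∀ j, |A.f j x| ≤ K * (1 + h) := by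
      intro j
      have e : A.f j x = A.f j (A.point X) + A.l j (x - A.point X) := by rw [A.f_sub]; ring
      rw [e]
      refine (abs_add_le _ _).trans ?_
      have h1 := Finset.single_le_sum (f := fun j => |A.f j (A.point X)|)
        (fun _ _ => abs_nonneg _) (Finset.mem_univ j)
      have h2 := hCl x hx j
      have h3 : 0 ≤ C * h := by positivity
      have h4 := mul_nonneg hS hhp.le
      have h5 : 0 ≤ M * (C * h) := by positivity
      have h6 : 0 ≤ M * C := by positivity
      rw [hK]
      nlinarith
    have hp1 : 1 ≤ K * (1 + h) := by nlinarith
    have hfpos : ∀ j, 0 < c * |A.f j x| := fun j => mul_pos hc (abs_pos.2 (hxc j))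
    have hprod : (∏ j, ‖A.fC j (A.rotate X t x)‖ ^ A.α j) *
        ∏ j ∈ X'.1, ‖A.fC j (A.rotate X t x)‖⁻¹ ≤
        (K * (1 + h)) ^ (∑ j, A.α j) * ∏ j ∈ X'.1, (c * |A.f j x|) ^ (min (A.α j) 1 - 1) := by
      have e1 : ∀ F : Fin N → ℝ, ∏ j ∈ X'.1, F j = ∏ j, if j ∈ X'.1 then F j else 1 := fun F => by
        rw [Finset.prod_ite_mem, Finset.univ_inter]
      rw [e1, e1, ← Finset.prod_mul_distrib, Real.rpow_sum_of_pos (by linarith),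
        ← Finset.prod_mul_distrib]
      refine Finset.prod_le_prod (fun j _ => ?_) fun j _ => ?_
      · split_ifs <;> positivity
      · split_ifs
        · exact rpow_mul_inv_le (A.α_pos j) (hfpos j) (hcl j) (hu j) hp1
        · rw [mul_one, mul_one]
          exact Real.rpow_le_rpow (norm_nonneg _) (hu j) (A.α_pos j).le
    have hexp : Real.exp (-β * h) ≤ Real.exp β * ∏ j ∈ X'.1, Real.exp (-η * |A.f j x|) := by
      rw [← Real.exp_sum, ← Real.exp_add]
      refine Real.exp_le_exp.2 ?_
      rw [← Finset.mul_sum]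
      have h1 : ∑ j ∈ X'.1, |A.f j x| ≤ k * (K * (1 + h)) := by
        refine (Finset.sum_le_card_nsmul _ _ _ fun j _ => hfx j).trans ?_
        rw [X'.2, nsmul_eq_mul]
      have h2 := mul_le_mul_of_nonneg_left h1 hηp.le
      have h3 : η * (k * (K * (1 + h))) = β * (1 + h) := by
        rw [hη]
        field_simp
      rw [h3] at h2
      linarith
    beta_reduce
    rw [A.norm_scaledIntegrand, Finset.prod_mul_distrib]
    set P := ∏ j ∈ X'.1, (c * |A.f j x|) ^ (min (A.α j) 1 - 1) with hP
    set Q := ∏ j ∈ X'.1, Real.exp (-η * |A.f j x|) with hQ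
    have hPn : 0 ≤ P := Finset.prod_nonneg fun j _ => Real.rpow_nonneg (hfpos j).le _
    have hlt : Real.exp (-lam * t.re * h) ≤ Real.exp (-β * h) * Real.exp (-β * h) := by
      rw [← Real.exp_add]
      refine Real.exp_le_exp.2 ?_
      have : lam * δ * h ≤ lam * t.re * h := by gcongr
      rw [hβ]
      linarith
    calc Real.exp (-lam * A.f0 (A.point X)) * Real.exp (-lam * t.re * h) *
          ((∏ j, ‖A.fC j (A.rotate X t x)‖ ^ A.α j) *
            ∏ j ∈ X'.1, ‖A.fC j (A.rotate X t x)‖⁻¹) * (‖t‖ ^ k * W)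
        ≤ Real.exp (-lam * A.f0 (A.point X)) * (Real.exp (-β * h) * Real.exp (-β * h)) *
          ((K * (1 + h)) ^ (∑ j, A.α j) * P) * (M ^ k * W) := by
          gcongr
      _ ≤ Real.exp (-lam * A.f0 (A.point X)) * (Real.exp (-β * h) * Real.exp (-β * h)) *
          ((C₁ * Real.exp (β * h)) * P) * (M ^ k * W) := by
          gcongr
          exact hC₁l h hhp.le
      _ = Real.exp (-lam * A.f0 (A.point X)) * Real.exp (-β * h) * (C₁ * P) * (M ^ k * W) := by
          have : Real.exp (-β * h) * Real.exp (β * h) = 1 := by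
            rw [← Real.exp_add]; simp
          linear_combination (Real.exp (-lam * A.f0 (A.point X)) * Real.exp (-β * h) * (C₁ * P) *
            (M ^ k * W)) * this
      _ ≤ Real.exp (-lam * A.f0 (A.point X)) * (Real.exp β * Q) * (C₁ * P) * (M ^ k * W) := by
          gcongr
      _ = C₂ * (P * Q) := by rw [hC₂]; ring

end Arrangement

/-! ### Integrals with a complex parameter, and limits of powers at the cut -/

/-- An integral depending on a complex parameter is differentiable if the integrand is
holomorphic in the parameter and locally dominated. -/
lemma differentiableAt_integral_of_dominated {β : Type*} [MeasurableSpace β] {μ : Measure β}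
    {F : ℂ → β → ℂ} {t₀ : ℂ} {R : ℝ} (hR : 0 < R) {B : β → ℝ} (hB : Integrable B μ)
    (hmeas : ∀ t ∈ Metric.ball t₀ R, AEStronglyMeasurable (F t) μ)
    (hdiff : ∀ᵐ a ∂μ, DifferentiableOn ℂ (fun t => F t a) (Metric.ball t₀ R))
    (hbound : ∀ᵐ a ∂μ, ∀ t ∈ Metric.ball t₀ R, ‖F t a‖ ≤ B a) :
    DifferentiableAt ℂ (fun t => ∫ a, F t a ∂μ) t₀ := by
  have ht₀ : t₀ ∈ Metric.ball t₀ R := Metric.mem_ball_self hR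
  -- Cauchy circles of radius `R / 3` about points of the ball of radius `R / 3` remain in the ball
  -- of radius `R`.
  have hR3 : 0 < R / 3 := by positivity
  have hsub : ∀ t ∈ Metric.ball t₀ (R / 3), Metric.closedBall t (R / 3) ⊆ Metric.ball t₀ R := by
    intro t ht u hu
    rw [Metric.mem_ball] at ht ⊢
    rw [Metric.mem_closedBall] at hu
    have := dist_triangle u t t₀
    linarith
  have hderiv : ∀ᵐ a ∂μ, ∀ t ∈ Metric.ball t₀ R,
      HasDerivAt (fun t => F t a) (deriv (fun t => F t a) t) t := by
    filter_upwards [hdiff] with a ha t ht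
    exact (ha.differentiableAt (Metric.isOpen_ball.mem_nhds ht)).hasDerivAt
  refine (hasDerivAt_integral_of_dominated_loc_of_deriv_le (F := F)
    (F' := fun t a => deriv (fun t => F t a) t)
    (bound := fun a => B a / (R / 3)) (Metric.ball_mem_nhds t₀ hR3) ?_ ?_ ?_ ?_
    (hB.div_const _) ?_).2.differentiableAt
  · filter_upwards [Metric.ball_mem_nhds t₀ hR] with t ht using hmeas t ht
  · refine hB.mono' (hmeas _ ht₀) ?_
    filter_upwards [hbound] with a ha using ha _ ht₀
  -- The derivative at `t₀` is measurable as a limit of difference quotients; the denominator `n +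
  -- 2` keeps `u n` strictly inside the ball for all `n`.
  · set u : ℕ → ℂ := fun n => t₀ + ((R / (n + 2) : ℝ) : ℂ) with hu
    have hpos : ∀ n : ℕ, 0 < R / ((n : ℝ) + 2) := fun n => by positivity
    have hune : ∀ n, u n ≠ t₀ := fun n h => by
      rw [hu] at h
      simp only [add_eq_left] at h
      exact (hpos n).ne' (by exact_mod_cast h)
    have hub : ∀ n, u n ∈ Metric.ball t₀ R := fun n => by
      rw [Metric.mem_ball, dist_eq_norm, hu]
      simp only [add_sub_cancel_left]
      rw [Complex.norm_real, Real.norm_of_nonneg (hpos n).le]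
      refine div_lt_self hR ?_
      have : (0 : ℝ) ≤ n := Nat.cast_nonneg n
      linarith
    have hulim : Tendsto u atTop (𝓝[≠] t₀) := by
      refine tendsto_nhdsWithin_iff.2 ⟨?_, Eventually.of_forall hune⟩
      have h1 : Tendsto (fun n : ℕ => R / ((n : ℝ) + 2)) atTop (𝓝 0) :=
        tendsto_const_nhds.div_atTop
          (tendsto_atTop_add_const_right _ _ tendsto_natCast_atTop_atTop)
      have h2 := (Complex.continuous_ofReal.tendsto 0).comp h1
      have h3 := h2.const_add t₀
      simpa only [Function.comp_def, Complex.ofReal_zero, add_zero] using h3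
    refine aestronglyMeasurable_of_tendsto_ae atTop
      (f := fun (n : ℕ) a => slope (fun t => F t a) t₀ (u n)) (fun n => ?_) ?_
    · simp only [slope_def_module, smul_eq_mul]
      exact ((hmeas _ (hub n)).sub (hmeas _ ht₀)).const_mul _
    · filter_upwards [hderiv] with a ha
      exact (hasDerivAt_iff_tendsto_slope.1 (ha _ ht₀)).comp hulim
  · filter_upwards [hdiff, hbound] with a ha hb t ht
    refine Complex.norm_deriv_le_of_forall_mem_sphere_norm_le hR3 ?_ fun z hz =>
      hb z (hsub t ht (Metric.sphere_subset_closedBall hz))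
    exact (ha.mono (hsub t ht)).diffContOnCl_ball subset_rfl
  · filter_upwards [hderiv] with a ha t ht
    exact ha t (hsub t ht (Metric.mem_closedBall_self hR3.le))

/-- The limits of a power at a negative real number, from either side. -/
lemma tendsto_cpow_of_neg {ι : Type*} {l : Filter ι} {w : ι → ℂ} {r σ : ℝ} (hr : r < 0)
    (hσ : σ = 1 ∨ σ = -1) (hw : Tendsto w l (𝓝 (r : ℂ))) (him : ∀ᶠ i in l, σ * (w i).im < 0)
    (α : ℝ) : Tendsto (fun i => w i ^ (α : ℂ)) l
      (𝓝 (((|r| ^ α : ℝ) : ℂ) * Complex.exp (-(σ * Complex.I * Real.pi * α)))) := by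
  have hr0 : (r : ℂ) ≠ 0 := by exact_mod_cast hr.ne
  have hlog : Tendsto (fun i => Complex.log (w i)) l
      (𝓝 ((Real.log |r| : ℝ) - σ * Real.pi * Complex.I)) := by
    have hn : ‖(r : ℂ)‖ = |r| := by rw [Complex.norm_real, Real.norm_eq_abs]
    -- At the cut the principal logarithm has imaginary part tending to `-π` from below (`σ = 1`)
    -- and to `π` from above (`σ = -1`).
    rcases hσ with rfl | rfl
    · have h := Complex.tendsto_log_nhdsWithin_im_neg_of_re_neg_of_im_zero
        (z := (r : ℂ)) (by simpa using hr) (Complex.ofReal_im r)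
      rw [hn] at h
      have h2 : Tendsto w l (𝓝[{z | z.im < 0}] (r : ℂ)) :=
        tendsto_nhdsWithin_iff.2 ⟨hw, by filter_upwards [him] with i hi; simpa using hi⟩
      simpa [Function.comp_def] using h.comp h2
    · have h := Complex.tendsto_log_nhdsWithin_im_nonneg_of_re_neg_of_im_zero
        (z := (r : ℂ)) (by simpa using hr) (Complex.ofReal_im r)
      rw [hn] at h
      have h2 : Tendsto w l (𝓝[{z | 0 ≤ z.im}] (r : ℂ)) :=
        tendsto_nhdsWithin_iff.2 ⟨hw, by
          filter_upwards [him] with i hi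
          have : 0 < (w i).im := by linarith
          exact this.le⟩
      simpa [Function.comp_def] using h.comp h2
  have hlim : ((|r| ^ α : ℝ) : ℂ) * Complex.exp (-(σ * Complex.I * Real.pi * α)) =
      Complex.exp (((Real.log |r| : ℝ) - σ * Real.pi * Complex.I) * α) := by
    rw [Real.rpow_def_of_pos (abs_pos.2 hr.ne), Complex.ofReal_exp, ← Complex.exp_add]
    congr 1
    push_cast
    ring
  rw [hlim]
  refine ((Complex.continuous_exp.tendsto _).comp (hlog.mul_const (α : ℂ))).congr' ?_
  filter_upwards [hw.eventually_ne hr0] with i hi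
  rw [Complex.cpow_def_of_ne_zero hi]
  rfl

namespace Arrangement

variable {k N : ℕ} (A : Arrangement k N)

/-! ### Measurability and holomorphy of the integrands -/

lemma ae_mem_compl : ∀ᵐ x : Fin k → ℝ, x ∈ A.compl := by
  refine ae_all_iff.2 fun j => ?_
  obtain ⟨X, hX⟩ := A.exists_vertex_superset {j} (by rw [Finset.card_singleton]; exact A.k_pos)
  have hj : j ∈ X.1 := hX (Finset.mem_singleton_self j)
  have hne : AffineSubspace.mk' (A.point X) (LinearMap.ker (A.l j)) ≠ ⊤ := by
    intro h
    have hd := congrArg AffineSubspace.direction h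
    rw [AffineSubspace.direction_mk', AffineSubspace.direction_top, LinearMap.ker_eq_top] at hd
    exact A.l_ne_zero j hd
  have h0 := Measure.addHaar_affineSubspace volume _ hne
  refine measure_mono_null (fun x hx => ?_) h0
  have hx' : A.f j x = 0 := by simpa using hx
  rw [SetLike.mem_coe, AffineSubspace.mem_mk', vsub_eq_sub, LinearMap.mem_ker,
    A.l_sub_point X hj, hx']

lemma scaledIntegrand_eq (X X' : A.Vertex) (lam t : ℂ) (x : Fin k → ℝ) :
    A.scaledIntegrand X lam X' t x = Complex.exp (-lam * complexify A.f0 (A.rotate X t x)) *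
      A.principalBranch X (A.rotate X t x) * (t ^ k * A.omega X' (A.rotate X t x) stdVec) := by
  rw [scaledIntegrand, omega_smul]

lemma analyticAt_complexify (φ : (Fin k → ℝ) →ₗ[ℝ] ℝ) (z : Fin k → ℂ) :
    AnalyticAt ℂ (complexify φ) z := by
  unfold complexify
  refine Finset.analyticAt_fun_sum _ fun i _ => ?_
  exact ((ContinuousLinearMap.proj (R := ℂ) (φ := fun _ : Fin k => ℂ) i).analyticAt z).mul
    analyticAt_const

lemma analyticAt_exp_complexify (lam : ℂ) (z : Fin k → ℂ) :
    AnalyticAt ℂ (fun z => Complex.exp (-lam * complexify A.f0 z)) z :=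
  (analyticAt_const.mul (analyticAt_complexify A.f0 z)).cexp

lemma analyticAt_omega (X : A.Vertex) {z : Fin k → ℂ} (hz : ∀ j, A.fC j z ≠ 0) :
    AnalyticAt ℂ (fun z => A.omega X z stdVec) z := by
  unfold omega
  refine AnalyticAt.mul (AnalyticAt.inv ?_ (Finset.prod_ne_zero_iff.2 fun j _ => hz j))
    analyticAt_const
  exact Finset.analyticAt_fun_prod _ fun j _ => A.analyticAt_fC j z

lemma fC_ne_zero_of_mem_slitPlane (X : A.Vertex) {z : Fin k → ℂ} {j : Fin N}
    (h : (A.side X j : ℂ) * A.fC j z ∈ Complex.slitPlane) : A.fC j z ≠ 0 := fun h0 => by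
  have := Complex.slitPlane_ne_zero h
  rw [h0, mul_zero] at this
  exact this rfl

lemma differentiableAt_scaledIntegrand (X X' : A.Vertex) (lam : ℂ) {t : ℂ} (ht : t.im ≠ 0)
    {x : Fin k → ℝ} (hx : x ∈ A.cone X) :
    DifferentiableAt ℂ (fun t => A.scaledIntegrand X lam X' t x) t := by
  simp only [scaledIntegrand_eq]
  have hs := A.side_mul_fC_mem_slitPlane X hx ht
  have hr := A.analyticAt_rotate X x t
  refine AnalyticAt.differentiableAt (AnalyticAt.mul (AnalyticAt.mul ?_ ?_)
    (AnalyticAt.mul (analyticAt_id.pow k) ?_))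
  · exact (A.analyticAt_exp_complexify lam _).comp_of_eq hr rfl
  · exact (A.analyticAt_principalBranch X hs).comp_of_eq hr rfl
  · exact (A.analyticAt_omega X' fun j =>
      A.fC_ne_zero_of_mem_slitPlane X (hs j)).comp_of_eq hr rfl

lemma continuous_rotate (X : A.Vertex) (t : ℂ) : Continuous (A.rotate X t) := by
  refine Continuous.add continuous_const (Continuous.const_smul ?_ t)
  refine continuous_pi fun i => Complex.continuous_ofReal.comp ?_
  exact (continuous_apply i).comp (continuous_id.sub continuous_const)

lemma continuous_incl : Continuous (incl : (Fin k → ℝ) → Fin k → ℂ) :=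
  continuous_pi fun i => Complex.continuous_ofReal.comp (continuous_apply i)

lemma measurableSet_cone (X : A.Vertex) : MeasurableSet (A.cone X) :=
  (A.isOpen_cone X).measurableSet

lemma aestronglyMeasurable_scaledIntegrand (X X' : A.Vertex) (lam : ℂ) {t : ℂ} (ht : t.im ≠ 0) :
    AEStronglyMeasurable (A.scaledIntegrand X lam X' t) (volume.restrict (A.cone X)) := by
  refine ContinuousOn.aestronglyMeasurable ?_ (A.measurableSet_cone X)
  intro x hx
  refine ContinuousAt.continuousWithinAt ?_
  have hs := A.side_mul_fC_mem_slitPlane X hx ht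
  have hr := (A.continuous_rotate X t).continuousAt (x := x)
  have e : A.scaledIntegrand X lam X' t = fun x =>
      Complex.exp (-lam * complexify A.f0 (A.rotate X t x)) *
      A.principalBranch X (A.rotate X t x) * (t ^ k * A.omega X' (A.rotate X t x) stdVec) :=
    funext fun x => A.scaledIntegrand_eq X X' lam t x
  rw [e]
  refine ContinuousAt.mul (ContinuousAt.mul ?_ ?_) (ContinuousAt.mul continuousAt_const ?_)
  · exact (A.analyticAt_exp_complexify lam _).continuousAt.comp_of_eq hr rfl
  · exact (A.analyticAt_principalBranch X hs).continuousAt.comp_of_eq hr rfl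
  · exact (A.analyticAt_omega X' fun j =>
      A.fC_ne_zero_of_mem_slitPlane X (hs j)).continuousAt.comp_of_eq hr rfl

lemma continuousAt_domainIntegrand (X' : A.Vertex) (lam : ℂ) {x : Fin k → ℝ}
    (hx : x ∈ A.compl) : ContinuousAt (A.domainIntegrand lam X') x := by
  unfold domainIntegrand
  refine ContinuousAt.mul (ContinuousAt.mul ?_ ?_) ?_
  · have : Continuous A.f0 := LinearMap.continuous_of_finiteDimensional _
    fun_prop
  · refine Complex.continuous_ofReal.continuousAt.comp ?_
    refine tendsto_finsetProd _ fun j _ => ?_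
    exact ((A.continuous_f j).abs.continuousAt).rpow_const (Or.inr (A.α_pos j).le)
  · exact (A.analyticAt_omega X' fun j => by
      rw [A.fC_incl]; exact_mod_cast hx j).continuousAt.comp_of_eq
        continuous_incl.continuousAt rfl

lemma isOpen_compl : IsOpen A.compl := by
  rw [compl, Set.ofPred_forall]
  exact isOpen_iInter_of_finite fun j =>
    isOpen_ne_fun (A.continuous_f j) continuous_const

lemma aestronglyMeasurable_domainIntegrand (X' : A.Vertex) (lam : ℂ) :
    AEStronglyMeasurable (A.domainIntegrand lam X') volume := by
  have h : volume.restrict A.compl = (volume : Measure (Fin k → ℝ)) :=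
    Measure.restrict_eq_self_of_ae_mem A.ae_mem_compl
  rw [← h]
  exact ContinuousOn.aestronglyMeasurable
    (fun x hx => (A.continuousAt_domainIntegrand X' lam hx).continuousWithinAt)
    A.isOpen_compl.measurableSet

/-! ### Independence of the direction of rotation -/

/-- The sector of the factors `t` with `0 < Re t` and `Im t` of the sign of `σ`. -/
def sector (σ : ℝ) : Set ℂ := {t | 0 < t.re ∧ 0 < σ * t.im}

lemma isOpen_sector (σ : ℝ) : IsOpen (sector σ) :=
  (isOpen_lt continuous_const Complex.continuous_re).inter
    (isOpen_lt continuous_const (continuous_const.mul Complex.continuous_im))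

lemma convex_sector (σ : ℝ) : Convex ℝ (sector σ) := by
  rintro w ⟨h1, h2⟩ w' ⟨h1', h2'⟩ a b ha hb hab
  have him : (a • w + b • w').im = a * w.im + b * w'.im := by simp
  have hre : (a • w + b • w').re = a * w.re + b * w'.re := by simp
  refine ⟨?_, ?_⟩
  · rw [hre]
    rcases ha.eq_or_lt with h | h
    · have : b = 1 := by linarith
      subst this
      rw [← h]; linarith
    · nlinarith [mul_pos h h1, mul_nonneg hb h1'.le]
  · rw [him]
    rcases ha.eq_or_lt with h | h
    · have : b = 1 := by linarith
      subst this
      rw [← h]; linarith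
    · nlinarith [mul_pos h h2, mul_nonneg hb h2'.le]

lemma im_ne_zero_of_mem_sector {σ : ℝ} {t : ℂ} (ht : t ∈ sector σ) : t.im ≠ 0 := fun h => by
  have := ht.2
  rw [h, mul_zero] at this
  exact lt_irrefl _ this

/-- Intended for `a = f j X` and `b = l j (x - X)`: the form at the rotated point is then at least
`c * |f j x|`. Indeed `|b| ≤ |a + t b| / |Im t|`, and `a + b` differs from `a + t b` by `(1 - t) b`.
-/
lemma exists_ball_sector {σ : ℝ} {t₀ : ℂ} (ht₀ : t₀ ∈ sector σ) :
    ∃ R c M δ : ℝ, 0 < R ∧ 0 < c ∧ 0 < M ∧ 0 < δ ∧ ∀ t ∈ Metric.ball t₀ R, t ∈ sector σ ∧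
      ‖t‖ ≤ M ∧ δ ≤ t.re ∧ ∀ a b : ℝ, c * |a + b| ≤ ‖(a : ℂ) + t * b‖ := by
  have him := abs_pos.2 (im_ne_zero_of_mem_sector ht₀)
  obtain ⟨R₁, hR₁, hsub⟩ := Metric.isOpen_iff.1 (isOpen_sector σ) t₀ ht₀
  -- Moving by less than `d` keeps both `Re t` and `|Im t|` at least `d`.
  set d := min t₀.re |t₀.im| / 2 with hd
  have hdp : 0 < d := by
    have := lt_min ht₀.1 him
    positivity
  have hd1 : 2 * d ≤ t₀.re := by rw [hd]; linarith [min_le_left t₀.re |t₀.im|]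
  have hd2 : 2 * d ≤ |t₀.im| := by rw [hd]; linarith [min_le_right t₀.re |t₀.im|]
  set M := ‖t₀‖ + d with hM
  have hMp : 0 < M := by positivity
  refine ⟨min R₁ d, (1 + (1 + M) / d)⁻¹, M, d, lt_min hR₁ hdp, by positivity, hMp, hdp, ?_⟩
  intro t ht
  have ht1 : t ∈ Metric.ball t₀ R₁ := Metric.ball_subset_ball (min_le_left _ _) ht
  have ht2 : ‖t - t₀‖ < d := by
    rw [← dist_eq_norm]
    exact lt_of_lt_of_le ht (min_le_right _ _)
  have hre := (Complex.abs_re_le_norm (t - t₀)).trans ht2.le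
  have him' := (Complex.abs_im_le_norm (t - t₀)).trans ht2.le
  rw [Complex.sub_re] at hre
  rw [Complex.sub_im] at him'
  have hn : ‖t‖ ≤ M := by
    have := norm_add_le (t - t₀) t₀
    rw [sub_add_cancel] at this
    rw [hM]
    linarith
  have hti : d ≤ |t.im| := by
    have := abs_sub_abs_le_abs_sub t₀.im t.im
    rw [abs_sub_comm] at this
    linarith
  refine ⟨hsub ht1, hn, ?_, fun a b => ?_⟩
  · have := (abs_le.1 hre).1
    linarith
  · set u := ‖(a : ℂ) + t * b‖ with hu
    have h1 : d * |b| ≤ u := by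
      refine le_trans ?_ (Complex.abs_im_le_norm _)
      have : ((a : ℂ) + t * b).im = t.im * b := by simp
      rw [this, abs_mul]
      gcongr
    have h2 : |a + b| ≤ u + (1 + M) * |b| := by
      have e : ((a + b : ℝ) : ℂ) = ((a : ℂ) + t * b) + (1 - t) * b := by push_cast; ring
      rw [← Real.norm_eq_abs (a + b), ← Complex.norm_real, e]
      refine (norm_add_le _ _).trans ?_
      rw [norm_mul, Complex.norm_real, Real.norm_eq_abs]
      have : ‖(1 : ℂ) - t‖ ≤ 1 + M := by
        refine (norm_sub_le _ _).trans ?_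
        rw [norm_one]
        linarith
      gcongr
    have h3 : |b| ≤ u / d := by rw [le_div_iff₀ hdp]; linarith
    have h4 : |a + b| ≤ (1 + (1 + M) / d) * u := by
      refine h2.trans ?_
      have h5 := mul_le_mul_of_nonneg_left h3 (by positivity : 0 ≤ 1 + M)
      have e : (1 + (1 + M) / d) * u = u + (1 + M) * (u / d) := by ring
      rw [e]
      linarith
    rw [inv_mul_le_iff₀ (by positivity)]
    exact h4

lemma f_eq_add (X : A.Vertex) (j : Fin N) (x : Fin k → ℝ) :
    A.f j x = A.f j (A.point X) + A.l j (x - A.point X) := by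
  rw [A.f_sub]; ring

lemma ae_cone (X : A.Vertex) :
    ∀ᵐ x ∂(volume.restrict (A.cone X)), x ∈ A.cone X ∧ x ∈ A.compl := by
  filter_upwards [ae_restrict_mem (A.measurableSet_cone X),
    ae_restrict_of_ae A.ae_mem_compl] with x h1 h2 using ⟨h1, h2⟩

lemma exists_bound_sector (X X' : A.Vertex) {lam σ : ℝ} (hlam : 0 < lam) {t₀ : ℂ}
    (ht₀ : t₀ ∈ sector σ) : ∃ (R : ℝ) (B : (Fin k → ℝ) → ℝ), 0 < R ∧ Integrable B ∧
      (∀ t ∈ Metric.ball t₀ R, t ∈ sector σ) ∧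
      ∀ x ∈ A.cone X, x ∈ A.compl → ∀ t ∈ Metric.ball t₀ R,
        ‖A.scaledIntegrand X lam X' t x‖ ≤ B x := by
  obtain ⟨R, c, M, δ, hR, hc, hM, hδ, h⟩ := exists_ball_sector ht₀
  obtain ⟨B, hB, hBb⟩ := A.exists_bound X X' hlam hc hM hδ
  refine ⟨R, B, hR, hB, fun t ht => (h t ht).1, fun x hx hxc t ht => ?_⟩
  obtain ⟨-, h2, h3, h4⟩ := h t ht
  refine hBb x hx hxc t h2 h3 fun j => ?_
  rw [A.fC_rotate, A.f_eq_add X j x]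
  exact h4 _ _

lemma integrableOn_scaledIntegrand (X X' : A.Vertex) {lam σ : ℝ} (hlam : 0 < lam) {t : ℂ}
    (ht : t ∈ sector σ) : IntegrableOn (A.scaledIntegrand X lam X' t) (A.cone X) := by
  obtain ⟨R, B, hR, hB, -, hb⟩ := A.exists_bound_sector X X' hlam ht
  refine hB.restrict.mono' (A.aestronglyMeasurable_scaledIntegrand X X' lam
    (im_ne_zero_of_mem_sector ht)) ?_
  filter_upwards [A.ae_cone X] with x hx using hb x hx.1 hx.2 t (Metric.mem_ball_self hR)

/-- The integral over the rotated cone is invariant under dilations of the cone. -/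
lemma integral_scaledIntegrand_smul (X X' : A.Vertex) (lam t : ℂ) {r : ℝ} (hr : 0 < r) :
    ∫ x in A.cone X, A.scaledIntegrand X lam X' (r * t) x =
      ∫ x in A.cone X, A.scaledIntegrand X lam X' t x := by
  set ψ := (A.cone X).indicator (A.scaledIntegrand X lam X' t) with hψ
  rw [← integral_indicator (A.measurableSet_cone X), ← integral_indicator (A.measurableSet_cone X)]
  have e : (A.cone X).indicator (fun x => A.scaledIntegrand X lam X' (r * t) x) =
      fun x => (r : ℂ) ^ k * ψ (A.point X + r • (x - A.point X)) := by
    ext x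
    have h : A.scaledIntegrand X lam X' (r * t) x =
        (r : ℂ) ^ k * A.scaledIntegrand X lam X' t (A.point X + r • (x - A.point X)) := by
      rw [scaledIntegrand_eq, scaledIntegrand_eq, A.rotate_smul, mul_pow]
      ring
    by_cases hx : x ∈ A.cone X
    · rw [indicator_of_mem hx, hψ, indicator_of_mem ((A.smul_mem_cone X hr).2 hx), h]
    · rw [indicator_of_notMem hx, hψ,
        indicator_of_notMem (fun h' => hx ((A.smul_mem_cone X hr).1 h')), mul_zero]
  -- The dilation about `X` has Jacobian `r ^ k`, which compensates the factor `r ^ k` coming from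
  -- the `k`-form.
  rw [e, integral_const_mul,
    integral_sub_right_eq_self (fun x => ψ (A.point X + r • x)) (A.point X),
    Measure.integral_comp_smul volume (fun x => ψ (A.point X + x)) r,
    integral_add_left_eq_self ψ (A.point X), Module.finrank_fin_fun,
    abs_of_pos (by positivity), Complex.real_smul, ← mul_assoc]
  have : (r : ℂ) ^ k * (((r ^ k)⁻¹ : ℝ) : ℂ) = 1 := by
    have : (r : ℂ) ≠ 0 := by exact_mod_cast hr.ne'
    push_cast
    field_simp
  rw [this, one_mul]

/-- The integral over the rotated cone does not depend on the factor in a sector. -/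
lemma integral_scaledIntegrand_eq (X X' : A.Vertex) {lam σ : ℝ} (hlam : 0 < lam) {t t' : ℂ}
    (ht : t ∈ sector σ) (ht' : t' ∈ sector σ) :
    ∫ x in A.cone X, A.scaledIntegrand X lam X' t x =
      ∫ x in A.cone X, A.scaledIntegrand X lam X' t' x := by
  set J : ℂ → ℂ := fun t => ∫ x in A.cone X, A.scaledIntegrand X lam X' t x with hJ
  have hdiff : ∀ t ∈ sector σ, DifferentiableAt ℂ J t := by
    intro t₀ ht₀
    obtain ⟨R, B, hR, hB, hs, hb⟩ := A.exists_bound_sector X X' hlam ht₀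
    refine differentiableAt_integral_of_dominated hR (B := B) hB.restrict
      (fun t ht => A.aestronglyMeasurable_scaledIntegrand X X' lam
        (im_ne_zero_of_mem_sector (hs t ht))) ?_ ?_
    · filter_upwards [A.ae_cone X] with x hx t ht
      exact (A.differentiableAt_scaledIntegrand X X' lam (im_ne_zero_of_mem_sector (hs t ht))
        hx.1).differentiableWithinAt
    · filter_upwards [A.ae_cone X] with x hx t ht using hb x hx.1 hx.2 t ht
  refine (isOpen_sector σ).is_const_of_deriv_eq_zero (convex_sector σ).isPreconnected
    (fun t ht => (hdiff t ht).differentiableWithinAt) (fun t ht => ?_) ht ht'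
  -- The derivative of `r ↦ J (r t)` at `r = 1` is computed twice: by the chain rule it is `t * J'
  -- t`, by dilation invariance it is `0`.
  have h1 : HasDerivAt (fun r : ℝ => J ((r : ℂ) * t)) (t * deriv J t) 1 := by
    have h2 : HasDerivAt (fun r : ℝ => (r : ℂ) * t) t 1 := by
      simpa using (Complex.ofRealCLM.hasDerivAt (x := (1 : ℝ))).mul_const t
    have h3 : HasDerivAt J (deriv J t) (((1 : ℝ) : ℂ) * t) := by
      rw [Complex.ofReal_one, one_mul]
      exact (hdiff t ht).hasDerivAt
    exact h3.scomp (1 : ℝ) h2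
  have h4 : HasDerivAt (fun r : ℝ => J ((r : ℂ) * t)) 0 1 := by
    refine (hasDerivAt_const (1 : ℝ) (J t)).congr_of_eventuallyEq ?_
    filter_upwards [lt_mem_nhds one_pos] with r hr
    exact A.integral_scaledIntegrand_smul X X' lam t hr
  have ht0 : t ≠ 0 := fun h => im_ne_zero_of_mem_sector ht (by rw [h]; rfl)
  exact (mul_eq_zero.1 (h1.unique h4)).resolve_left ht0

/-! ### Boundary values on the real cone -/

/-- The factor acquired by `∏ j, |f j| ^ α j` on passing, on the side `σ`, from the domain
of signs `s` to the one of `x`. -/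
noncomputable def phase (σ : ℝ) (s : Fin N → ℝ) (x : Fin k → ℝ) : ℂ :=
  ∏ j, if s j * A.f j x < 0 then Complex.exp (-(σ * Complex.I * Real.pi * A.α j)) else 1

lemma norm_phase (σ : ℝ) (s : Fin N → ℝ) (x : Fin k → ℝ) : ‖A.phase σ s x‖ = 1 := by
  rw [phase, norm_prod]
  refine Finset.prod_eq_one fun j _ => ?_
  split_ifs
  · rw [Complex.norm_exp]
    simp
  · exact norm_one

lemma measurable_phase (σ : ℝ) (s : Fin N → ℝ) : Measurable (A.phase σ s) := by
  unfold phase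
  refine Finset.measurable_fun_prod _ fun j _ => Measurable.ite ?_ measurable_const
    measurable_const
  exact (isOpen_lt (continuous_const.mul (A.continuous_f j)) continuous_const).measurableSet

lemma rotate_one (X : A.Vertex) (x : Fin k → ℝ) : A.rotate X 1 x = incl x := by
  have := A.rotate_ofReal X 1 x
  rwa [Complex.ofReal_one, one_smul, add_sub_cancel] at this

lemma abs_side_mul (X : A.Vertex) (j : Fin N) (r : ℝ) : |A.side X j * r| = |r| := by
  rw [abs_mul]
  rcases A.side_eq_or X j with e | e <;> rw [e] <;> simp

lemma norm_domainIntegrand (X X' : A.Vertex) (lam : ℝ) (x : Fin k → ℝ) :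
    ‖A.domainIntegrand lam X' x‖ = ‖A.scaledIntegrand X lam X' 1 x‖ := by
  rw [domainIntegrand, scaledIntegrand_eq, A.rotate_one, complexify_incl, one_pow, one_mul,
    norm_mul, norm_mul, norm_mul, norm_mul, A.norm_principalBranch, Complex.norm_real,
    Real.norm_of_nonneg (Finset.prod_nonneg fun j _ => Real.rpow_nonneg (abs_nonneg _) _)]
  congr 2
  refine Finset.prod_congr rfl fun j _ => ?_
  rw [A.fC_incl, Complex.norm_real, Real.norm_eq_abs]

/-- In absolute value the real density is the case `t = 1` of the rotated one, where the bound holds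
with `c = 1`. -/
lemma integrableOn_domainIntegrand_cone (X X' : A.Vertex) {lam : ℝ} (hlam : 0 < lam) :
    IntegrableOn (A.domainIntegrand lam X') (A.cone X) := by
  obtain ⟨B, hB, hb⟩ := A.exists_bound X X' (c := 1) (M := 1) (δ := 1) hlam one_pos one_pos
    one_pos
  refine hB.restrict.mono' (A.aestronglyMeasurable_domainIntegrand X' lam).restrict ?_
  filter_upwards [A.ae_cone X] with x hx
  rw [A.norm_domainIntegrand X]
  refine hb x hx.1 hx.2 1 norm_one.le Complex.one_re.ge fun j => ?_
  rw [A.rotate_one, A.fC_incl, Complex.norm_real, one_mul, Real.norm_eq_abs]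

lemma integrableOn_domainIntegrand_mul_phase (X X' : A.Vertex) {lam : ℝ} (hlam : 0 < lam)
    (σ : ℝ) (s : Fin N → ℝ) :
    IntegrableOn (fun x => A.domainIntegrand lam X' x * A.phase σ s x) (A.cone X) := by
  refine Integrable.mono (A.integrableOn_domainIntegrand_cone X X' hlam) ?_ ?_
  · exact ((A.aestronglyMeasurable_domainIntegrand X' lam).mul
      (A.measurable_phase σ s).aestronglyMeasurable).restrict
  · exact Eventually.of_forall fun x => by rw [norm_mul, A.norm_phase, mul_one]

/-- The boundary values of the determination by principal powers on the real cone. -/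
lemma tendsto_principalBranch (X : A.Vertex) {σ : ℝ} (hσ : σ = 1 ∨ σ = -1) {t : ℕ → ℂ}
    (ht : ∀ n, t n ∈ sector σ) (hlim : Tendsto t atTop (𝓝 1)) {x : Fin k → ℝ}
    (hx : x ∈ A.cone X) (hxc : x ∈ A.compl) :
    Tendsto (fun n => A.principalBranch X (A.rotate X (t n) x)) atTop
      (𝓝 (((∏ j, |A.f j x| ^ A.α j : ℝ) : ℂ) * A.phase σ (A.side X) x)) := by
  rw [Complex.ofReal_prod, phase, ← Finset.prod_mul_distrib]
  refine tendsto_finsetProd _ fun j _ => ?_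
  have hw : Tendsto (fun n => (A.side X j : ℂ) * A.fC j (A.rotate X (t n) x)) atTop
      (𝓝 ((A.side X j * A.f j x : ℝ) : ℂ)) := by
    have hc : ContinuousAt (fun t : ℂ => (A.side X j : ℂ) * A.fC j (A.rotate X t x)) 1 :=
      continuousAt_const.mul ((A.analyticAt_fC j _).continuousAt.comp_of_eq
        (A.analyticAt_rotate X x 1).continuousAt rfl)
    have := hc.tendsto.comp hlim
    rw [A.rotate_one, A.fC_incl, ← Complex.ofReal_mul] at this
    exact this
  split_ifs with hneg
  -- A form whose sign at `x` differs from that on `Δ_X` does not vanish at `X`. Its sign changes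
  -- between `X` and `x`, so `side * l j (x - X) < 0`, and the rotated value approaches the cut on
  -- the side opposite to `σ`.
  · have hj : j ∉ X.1 := fun hj =>
      absurd ((A.mem_cone_iff X x).1 hx j hj) (not_lt.2 hneg.le)
    rw [← A.abs_side_mul X j (A.f j x)]
    refine tendsto_cpow_of_neg hneg hσ hw (Eventually.of_forall fun n => ?_) (A.α j)
    have h1 := A.side_mul_point_pos X hj
    have h2 : A.side X j * A.l j (x - A.point X) < 0 := by
      rw [A.f_eq_add X j x, mul_add] at hneg
      linarith
    have h3 : ((A.side X j : ℂ) * A.fC j (A.rotate X (t n) x)).im =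
        (t n).im * (A.side X j * A.l j (x - A.point X)) := by
      rw [A.fC_rotate]
      simp [-map_sub]
      ring
    rw [h3, ← mul_assoc]
    exact mul_neg_of_pos_of_neg (ht n).2 h2
  · have hpos : 0 < A.side X j * A.f j x :=
      lt_of_le_of_ne (not_lt.1 hneg) (mul_ne_zero (A.side_ne_zero X j) (hxc j)).symm
    rw [mul_one, ← A.abs_side_mul X j (A.f j x), Complex.ofReal_cpow (abs_nonneg _),
      abs_of_pos hpos]
    exact hw.cpow tendsto_const_nhds (Complex.ofReal_mem_slitPlane.2 hpos)

lemma tendsto_scaledIntegrand (X X' : A.Vertex) (lam : ℂ) {σ : ℝ} (hσ : σ = 1 ∨ σ = -1)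
    {t : ℕ → ℂ} (ht : ∀ n, t n ∈ sector σ) (hlim : Tendsto t atTop (𝓝 1)) {x : Fin k → ℝ}
    (hx : x ∈ A.cone X) (hxc : x ∈ A.compl) :
    Tendsto (fun n => A.scaledIntegrand X lam X' (t n) x) atTop
      (𝓝 (A.domainIntegrand lam X' x * A.phase σ (A.side X) x)) := by
  simp only [scaledIntegrand_eq]
  have e : A.domainIntegrand lam X' x * A.phase σ (A.side X) x =
      Complex.exp (-lam * complexify A.f0 (A.rotate X 1 x)) *
      (((∏ j, |A.f j x| ^ A.α j : ℝ) : ℂ) * A.phase σ (A.side X) x) *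
      (1 ^ k * A.omega X' (A.rotate X 1 x) stdVec) := by
    rw [A.rotate_one, complexify_incl, domainIntegrand]
    ring
  rw [e]
  have hr := (A.analyticAt_rotate X x 1).continuousAt
  refine (Tendsto.mul ?_ (A.tendsto_principalBranch X hσ ht hlim hx hxc)).mul
    (Tendsto.mul (hlim.pow k) ?_)
  · exact ((A.analyticAt_exp_complexify lam _).continuousAt.comp_of_eq hr rfl).tendsto.comp hlim
  · refine ((A.analyticAt_omega X' fun j => ?_).continuousAt.comp_of_eq hr rfl).tendsto.comp hlim
    rw [A.rotate_one, A.fC_incl]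
    exact_mod_cast hxc j

/-- The integral over the rotated cone as an integral over the real cone. -/
lemma integral_scaledIntegrand_eq_phase (X X' : A.Vertex) {lam σ : ℝ} (hlam : 0 < lam)
    (hσ : σ = 1 ∨ σ = -1) {t : ℂ} (ht : t ∈ sector σ) :
    ∫ x in A.cone X, A.scaledIntegrand X lam X' t x =
      ∫ x in A.cone X, A.domainIntegrand lam X' x * A.phase σ (A.side X) x := by
  -- Approaching `1` along `Re t = 1` makes `f j x` the real part of the rotated form, so the
  -- rotated forms are never closer to `0` than the real ones and a single bound dominates the
  -- sequence.
  set u : ℕ → ℂ := fun n => ⟨1, σ * (1 / ((n : ℝ) + 1))⟩ with hu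
  have hσσ : σ * σ = 1 := by rcases hσ with h | h <;> rw [h] <;> norm_num
  have hσa : |σ| = 1 := by rcases hσ with h | h <;> rw [h] <;> norm_num
  have hpos : ∀ n : ℕ, 0 < 1 / ((n : ℝ) + 1) := fun n => by positivity
  have hus : ∀ n, u n ∈ sector σ := fun n => by
    refine ⟨one_pos, ?_⟩
    change 0 < σ * (σ * (1 / ((n : ℝ) + 1)))
    rw [← mul_assoc, hσσ, one_mul]
    exact hpos n
  have hulim : Tendsto u atTop (𝓝 1) := by
    have h1 : Tendsto (fun n : ℕ => σ * (1 / ((n : ℝ) + 1))) atTop (𝓝 0) := by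
      simpa using tendsto_one_div_add_atTop_nhds_zero_nat.const_mul σ
    have h2 : Tendsto (fun n : ℕ => (1 : ℂ) + ((σ * (1 / ((n : ℝ) + 1)) : ℝ) : ℂ) * Complex.I)
        atTop (𝓝 (1 + ((0 : ℝ) : ℂ) * Complex.I)) :=
      (((Complex.continuous_ofReal.tendsto 0).comp h1).mul_const _).const_add _
    rw [Complex.ofReal_zero, zero_mul, add_zero] at h2
    refine h2.congr fun n => ?_
    rw [hu]
    beta_reduce
    rw [Complex.mk_eq_add_mul_I, Complex.ofReal_one]
  obtain ⟨B, hB, hb⟩ := A.exists_bound X X' (c := 1) (M := 2) (δ := 1) hlam one_pos two_pos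
    one_pos
  have hlim := tendsto_integral_filter_of_dominated_convergence (l := atTop)
    (μ := volume.restrict (A.cone X)) (F := fun n x => A.scaledIntegrand X lam X' (u n) x)
    (f := fun x => A.domainIntegrand lam X' x * A.phase σ (A.side X) x) B
    (Eventually.of_forall fun n => A.aestronglyMeasurable_scaledIntegrand X X' lam
      (im_ne_zero_of_mem_sector (hus n))) (Eventually.of_forall fun n => ?_) hB.restrict ?_
  · refine tendsto_nhds_unique (tendsto_const_nhds.congr fun n => ?_) hlim
    exact A.integral_scaledIntegrand_eq X X' hlam ht (hus n)
  · filter_upwards [A.ae_cone X] with x hx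
    refine hb x hx.1 hx.2 (u n) ?_ le_rfl fun j => ?_
    · refine (Complex.norm_le_abs_re_add_abs_im _).trans ?_
      change |(1 : ℝ)| + |σ * (1 / ((n : ℝ) + 1))| ≤ 2
      rw [abs_mul, hσa, abs_of_pos (hpos n), abs_one, one_mul]
      have : 1 / ((n : ℝ) + 1) ≤ 1 := by
        rw [div_le_one (by positivity)]
        linarith [(Nat.cast_nonneg n : (0 : ℝ) ≤ n)]
      linarith
    · rw [A.fC_rotate, one_mul, A.f_eq_add X j x]
      refine le_trans (le_of_eq ?_) (Complex.abs_re_le_norm _)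
      congr 1
      simp [-map_sub, hu]
  · filter_upwards [A.ae_cone X] with x hx
    exact A.tendsto_scaledIntegrand X X' lam hσ hus hulim hx.1 hx.2

lemma coneIntegrand_eq (X X' : A.Vertex) (lam : ℂ) {ρ : ℂ} (him : ρ.im ≠ 0)
    {x : Fin k → ℝ} (hx : x ∈ A.cone X) :
    A.coneIntegrand X ρ lam X' x = A.scaledIntegrand X lam X' ρ x := by
  have h : 0 < Real.sign ρ.im * ρ.im := (sign_mul_pos_iff him).2 (mul_self_pos.2 him)
  rw [coneIntegrand, scaledIntegrand, A.branch_rotate X _ h hx]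

lemma integrableOn_coneIntegrand (X X' : A.Vertex) {lam σ : ℝ} (hlam : 0 < lam) {ρ : ℂ}
    (hρ : ρ ∈ sector σ) : IntegrableOn (A.coneIntegrand X ρ lam X') (A.cone X) :=
  (A.integrableOn_scaledIntegrand X X' hlam hρ).congr_fun
    (fun _ hx => (A.coneIntegrand_eq X X' lam (im_ne_zero_of_mem_sector hρ) hx).symm)
    (A.measurableSet_cone X)

lemma integralCone_eq (X : A.Vertex) {lam σ : ℝ} (hlam : 0 < lam) (hσ : σ = 1 ∨ σ = -1)
    {ρ : ℂ} (hρ : ρ ∈ sector σ) : A.integralCone X ρ lam = fun X' =>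
      ∫ x in A.cone X, A.domainIntegrand lam X' x * A.phase σ (A.side X) x := by
  funext X'
  rw [← A.integral_scaledIntegrand_eq_phase X X' hlam hσ hρ]
  exact setIntegral_congr_fun (A.measurableSet_cone X)
    fun _ hx => A.coneIntegrand_eq X X' lam (im_ne_zero_of_mem_sector hρ) hx

/-! ### Assembly of the expansions -/

/-- The hyperplanes separating `Δ` from `Δ_X` pass through `X`, and on the cone their forms have the
signs of `Δ_X`. They contribute nothing to the phase measured from `Δ_X` and one exponential each to
the phase measured from `Δ`; all other hyperplanes contribute equally to both. -/
lemma exp_weight_mul_phase (σ : ℝ) (s : Fin N → ℝ) (hs : ∀ j, s j = 1 ∨ s j = -1)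
    (hne : (A.chamber s).Nonempty) (X : A.Vertex)
    (hX : X ∈ A.boundaryVertices (A.chamber s)) {x : Fin k → ℝ} (hx : x ∈ A.cone X) :
    Complex.exp (-(σ * Complex.I * Real.pi *
      A.weight (separating A (A.chamber s) (A.domainAt X)))) * A.phase σ (A.side X) x =
    A.phase σ s x := by
  classical
  have hfr : ∀ j ∉ X.1, 0 < s j * A.f j (A.point X) := by
    rw [boundaryVertices, Finset.mem_filter, A.mem_frontier_chamber s hs] at hX
    exact hX.2
  have hsep : ∀ j, j ∈ separating A (A.chamber s) (A.domainAt X) ↔ s j ≠ A.side X j := fun j => by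
    rw [A.domainAt_eq, A.mem_separating_chamber s _ hs (A.side_eq_or X) hne
      (by rw [← A.domainAt_eq]; exact A.domainAt_nonempty X)]
  have hexp : Complex.exp (-(σ * Complex.I * Real.pi *
      A.weight (separating A (A.chamber s) (A.domainAt X)))) =
      ∏ j, if s j ≠ A.side X j then Complex.exp (-(σ * Complex.I * Real.pi * A.α j)) else 1 := by
    rw [weight, Complex.ofReal_sum, Finset.mul_sum, ← Finset.sum_neg_distrib, Complex.exp_sum,
      ← Finset.prod_filter]
    refine Finset.prod_congr ?_ fun _ _ => rfl
    ext j
    simp [hsep]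
  rw [hexp, phase, phase, ← Finset.prod_mul_distrib]
  refine Finset.prod_congr rfl fun j _ => ?_
  by_cases h : s j = A.side X j
  · rw [if_neg (not_not.2 h), one_mul, h]
  · have hj : j ∈ X.1 := by
      by_contra hj
      exact h (A.side_eq_of_notMem s hs X hj (hfr j hj))
    have h1 := (A.mem_cone_iff X x).1 hx j hj
    have h2 : s j = -A.side X j := by
      rcases hs j with e | e <;> rcases A.side_eq_or X j with e' | e' <;> rw [e, e'] at h ⊢ <;>
        first | exact absurd rfl h | norm_num
    rw [if_pos h, if_neg (not_lt.2 h1.le), if_pos (by rw [h2]; linarith), mul_one]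

lemma mem_compl_of_mem_chamber {s : Fin N → ℝ} {x : Fin k → ℝ} (hx : x ∈ A.chamber s) :
    x ∈ A.compl := fun j h => by
  have := hx j
  rw [h, mul_zero] at this
  exact lt_irrefl _ this

/-- The signed count of cones at a point of the domain is `1`, so some term is nonzero.
Integrability on the domain thus follows from that on finitely many cones. -/
lemma chamber_subset_iUnion_cone (s : Fin N → ℝ) (hs : ∀ j, s j = 1 ∨ s j = -1)
    (hne : (A.chamber s).Nonempty) (hb : BddBelow (A.f0 '' A.chamber s)) :
    A.chamber s ⊆ ⋃ X : A.Vertex, A.cone X := by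
  intro x hx
  have h := A.sum_indicator_cone s hs hne hb x (A.mem_compl_of_mem_chamber hx)
  rw [if_pos hx] at h
  obtain ⟨X, -, hX⟩ := Finset.exists_ne_zero_of_sum_ne_zero (h.trans_ne one_ne_zero)
  exact mem_iUnion.2 ⟨X, by by_contra hc; rw [if_neg hc] at hX; exact hX rfl⟩

lemma integrableOn_domainIntegrand_chamber (s : Fin N → ℝ) (hs : ∀ j, s j = 1 ∨ s j = -1)
    (hne : (A.chamber s).Nonempty) (hb : BddBelow (A.f0 '' A.chamber s)) {lam : ℝ}
    (hlam : 0 < lam) (X' : A.Vertex) :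
    IntegrableOn (A.domainIntegrand lam X') (A.chamber s) :=
  (integrableOn_finite_iUnion.2 fun X =>
    A.integrableOn_domainIntegrand_cone X X' hlam).mono_set
    (A.chamber_subset_iUnion_cone s hs hne hb)

/-- The integral over a domain as a combination of boundary values of those over the rotated
cones at its vertices. -/
lemma setIntegral_chamber (s : Fin N → ℝ) (hs : ∀ j, s j = 1 ∨ s j = -1)
    (hne : (A.chamber s).Nonempty) (hb : BddBelow (A.f0 '' A.chamber s)) {lam : ℝ}
    (hlam : 0 < lam) (σ : ℝ) (X' : A.Vertex) :
    ∫ x in A.chamber s, A.domainIntegrand lam X' x =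
      ∑ X ∈ A.boundaryVertices (A.chamber s),
        ((-1) ^ (separating A (A.chamber s) (A.domainAt X)).card *
          Complex.exp (-(σ * Complex.I * Real.pi *
            A.weight (separating A (A.chamber s) (A.domainAt X))))) *
        ∫ x in A.cone X, A.domainIntegrand lam X' x * A.phase σ (A.side X) x := by
  classical
  have hint : ∀ X : A.Vertex, Integrable ((A.cone X).indicator
      fun x => A.domainIntegrand lam X' x * A.phase σ (A.side X) x) := fun X =>
    (integrable_indicator_iff (A.measurableSet_cone X)).2
      (A.integrableOn_domainIntegrand_mul_phase X X' hlam σ _)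
  rw [← integral_indicator (A.isOpen_chamber s).measurableSet]
  simp_rw [← integral_indicator (A.measurableSet_cone _), ← integral_const_mul]
  rw [← integral_finsetSum _ fun X _ => (hint X).const_mul _]
  refine integral_congr_ae ?_
  filter_upwards [A.ae_mem_compl] with x hx
  -- The indicator identity is multiplied by the density times the phase measured from `Δ`: on the
  -- domain this phase is `1`, and on each cone it produces the coefficient of that cone.
  have h := congrArg (fun n : ℤ => (n : ℂ) * (A.domainIntegrand lam X' x * A.phase σ s x))
    (A.sum_indicator_cone s hs hne hb x hx)
  simp only [Int.cast_sum, Finset.sum_mul] at h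
  have hl : (A.chamber s).indicator (A.domainIntegrand lam X') x =
      (((if x ∈ A.chamber s then 1 else 0 : ℤ) : ℤ) : ℂ) *
        (A.domainIntegrand lam X' x * A.phase σ s x) := by
    by_cases hxs : x ∈ A.chamber s
    · have : A.phase σ s x = 1 := Finset.prod_eq_one fun j _ => if_neg (not_lt.2 (hxs j).le)
      rw [indicator_of_mem hxs, if_pos hxs, this]
      simp
    · rw [indicator_of_notMem hxs, if_neg hxs]
      simp
  rw [hl, ← h]
  refine Finset.sum_congr rfl fun X hX => ?_
  by_cases hxX : x ∈ A.cone X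
  · rw [if_pos hxX, indicator_of_mem hxX, ← A.exp_weight_mul_phase σ s hs hne X hX hxX]
    push_cast
    ring
  · rw [if_neg hxX, indicator_of_notMem hxX]
    simp

lemma mem_sector_of_re_mul_pos {lam : ℝ} (hlam : 0 < lam) {σ : ℝ} {ρ : ℂ}
    (him : 0 < σ * ρ.im) (hre : 0 < (ρ * lam).re) : ρ ∈ sector σ := by
  refine ⟨?_, him⟩
  rw [Complex.re_mul_ofReal] at hre
  exact pos_of_mul_pos_left hre hlam.le

/-- The boundary integral is a common value, so the choice made by `epsilon` is one too; the
explicit admissible unit `(3 - 4i) / 5` shows that a common value is unique. -/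
lemma integralPlus_eq (X : A.Vertex) {lam : ℝ} (hlam : 0 < lam) :
    A.integralPlus X lam = fun X' =>
      ∫ x in A.cone X, A.domainIntegrand lam X' x * A.phase (-1) (A.side X) x := by
  have hex : ∀ ρ : ℂ, ‖ρ‖ = 1 → ρ.im < 0 → 0 < (ρ * lam).re → A.integralCone X ρ lam = fun X' =>
      ∫ x in A.cone X, A.domainIntegrand lam X' x * A.phase (-1) (A.side X) x :=
    fun ρ _ him hre => A.integralCone_eq X hlam (Or.inr rfl)
      (mem_sector_of_re_mul_pos hlam (by linarith) hre)
  have hspec : ∀ ρ : ℂ, ‖ρ‖ = 1 → ρ.im < 0 → 0 < (ρ * lam).re →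
      A.integralCone X ρ lam = A.integralPlus X lam :=
    Classical.epsilon_spec (p := fun c => ∀ ρ : ℂ, ‖ρ‖ = 1 → ρ.im < 0 → 0 < (ρ * lam).re →
      A.integralCone X ρ lam = c) ⟨_, hex⟩
  have hn : ‖(⟨3 / 5, -(4 / 5)⟩ : ℂ)‖ = 1 := by
    rw [Complex.norm_def, Complex.normSq_mk]
    norm_num
  have h1 : (⟨3 / 5, -(4 / 5)⟩ : ℂ).im < 0 := by norm_num
  have h2 : 0 < ((⟨3 / 5, -(4 / 5)⟩ : ℂ) * lam).re := by
    rw [Complex.re_mul_ofReal]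
    positivity
  exact (hspec _ hn h1 h2).symm.trans (hex _ hn h1 h2)

lemma integralMinus_eq (X : A.Vertex) {lam : ℝ} (hlam : 0 < lam) :
    A.integralMinus X lam = fun X' =>
      ∫ x in A.cone X, A.domainIntegrand lam X' x * A.phase 1 (A.side X) x := by
  have hex : ∀ ρ : ℂ, ‖ρ‖ = 1 → 0 < ρ.im → 0 < (ρ * lam).re → A.integralCone X ρ lam = fun X' =>
      ∫ x in A.cone X, A.domainIntegrand lam X' x * A.phase 1 (A.side X) x :=
    fun ρ _ him hre => A.integralCone_eq X hlam (Or.inl rfl)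
      (mem_sector_of_re_mul_pos hlam (by linarith) hre)
  have hspec : ∀ ρ : ℂ, ‖ρ‖ = 1 → 0 < ρ.im → 0 < (ρ * lam).re →
      A.integralCone X ρ lam = A.integralMinus X lam :=
    Classical.epsilon_spec (p := fun c => ∀ ρ : ℂ, ‖ρ‖ = 1 → 0 < ρ.im → 0 < (ρ * lam).re →
      A.integralCone X ρ lam = c) ⟨_, hex⟩
  have hn : ‖(⟨3 / 5, 4 / 5⟩ : ℂ)‖ = 1 := by
    rw [Complex.norm_def, Complex.normSq_mk]
    norm_num
  have h1 : 0 < (⟨3 / 5, 4 / 5⟩ : ℂ).im := by norm_num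
  have h2 : 0 < ((⟨3 / 5, 4 / 5⟩ : ℂ) * lam).re := by
    rw [Complex.re_mul_ofReal]
    positivity
  exact (hspec _ hn h1 h2).symm.trans (hex _ hn h1 h2)

end Arrangement

theorem lemma4 {k N : ℕ} (A : Arrangement k N) (Δ : Set (Fin k → ℝ)) (hΔ : Δ ∈ A.domainsPlus)
    (lam : ℝ) (hlam : 0 < lam) :
    -- the integrals over `Δ` converge
    (∀ X' : A.Vertex, IntegrableOn (A.domainIntegrand lam X') Δ) ∧
    -- the integrals over the rotated cones converge
    (∀ (X X' : A.Vertex) (ρ : ℂ), ‖ρ‖ = 1 → ρ.im ≠ 0 → 0 < (ρ * lam).re →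
      IntegrableOn (A.coneIntegrand X ρ lam X') (A.cone X)) ∧
    -- and have the common values `I_X^+` (for `Im ρ < 0`) and `I_X^-` (for `Im ρ > 0`)
    (∀ (X : A.Vertex) (ρ : ℂ), ‖ρ‖ = 1 → ρ.im < 0 → 0 < (ρ * lam).re →
      A.integralCone X ρ lam = A.integralPlus X lam) ∧
    (∀ (X : A.Vertex) (ρ : ℂ), ‖ρ‖ = 1 → 0 < ρ.im → 0 < (ρ * lam).re →
      A.integralCone X ρ lam = A.integralMinus X lam) ∧
    -- the two expansions
    A.integralDomain Δ lam =
      ∑ X ∈ A.boundaryVertices Δ, A.psi Δ X • A.integralPlus X lam ∧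
    A.integralDomain Δ lam =
      ∑ X ∈ A.boundaryVertices Δ, (starRingEnd ℂ) (A.psi Δ X) • A.integralMinus X lam := by
  obtain ⟨hdom, hb⟩ := hΔ
  obtain ⟨s, hs, rfl, hne⟩ := A.exists_signs hdom
  refine ⟨fun X' => A.integrableOn_domainIntegrand_chamber s hs hne hb hlam X',
    fun X X' ρ _ him hre => ?_, fun X ρ _ him hre => ?_, fun X ρ _ him hre => ?_, ?_, ?_⟩
  -- Taking `σ = Im ρ` treats both half-planes at once, as `σ * Im ρ` is a square.
  · exact A.integrableOn_coneIntegrand X X' (σ := ρ.im) hlam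
      (Arrangement.mem_sector_of_re_mul_pos hlam (mul_self_pos.2 him) hre)
  · rw [A.integralPlus_eq X hlam]
    exact A.integralCone_eq X hlam (Or.inr rfl)
      (Arrangement.mem_sector_of_re_mul_pos hlam (by linarith) hre)
  · rw [A.integralMinus_eq X hlam]
    exact A.integralCone_eq X hlam (Or.inl rfl)
      (Arrangement.mem_sector_of_re_mul_pos hlam (by linarith) hre)
  -- For `σ = -1`, that is `Im ρ < 0`, the exponential of the weight is `exp (iπα_H)`, as in `psi`.
  · funext X'
    rw [Arrangement.integralDomain, A.setIntegral_chamber s hs hne hb hlam (-1) X',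
      Finset.sum_apply]
    refine Finset.sum_congr rfl fun X _ => ?_
    rw [Pi.smul_apply, smul_eq_mul, A.integralPlus_eq X hlam, A.psi_eq]
    congr 3
    push_cast
    ring
  -- For `σ = 1` the exponential is the conjugate one, while the sign `(-1) ^ |H|` is real.
  · funext X'
    rw [Arrangement.integralDomain, A.setIntegral_chamber s hs hne hb hlam 1 X',
      Finset.sum_apply]
    refine Finset.sum_congr rfl fun X _ => ?_
    rw [Pi.smul_apply, smul_eq_mul, A.integralMinus_eq X hlam, A.psi_eq, map_mul, map_pow,
      map_neg, map_one, ← Complex.exp_conj]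
    congr 3
    simp
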